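/- Let $K$ be a finite extension of $\mathbb{Q}_p$ with ring of integers $\mathcal{O}_K$, uniformiser $\pi$, residue field $k$, normalised valuation $v$ and absolute value $|x|=c^{-v(x)}$ for some constant $c>1$ (with $|0|=0$). Reduction modulo $\pi$ is denoted by $\widetilde{\phantom{x}}$. For a ternary cubic over $K$, $$U = a x^3+by^3+cz^3+fy^2z+gz^2x+hx^2y+iyz^2+jzx^2+kxy^2+mxyz,$$ let $b_2=m^2-4(fj+gk+hi)$, let $(U_{rs})$ be the $3\times 3$ matrix of second partial derivatives of $U$, let $H=-\tfrac12\det(U_{rs})$, let $\Theta$ be $\tfrac13$ times the determinant of the $4\times4$ matrix obtained by bordering $(U_{rs})$ by the gradient of $H$ (last row and last column) with $0$ in the corner, and put $$Z=\tfrac14(H+b_2U),\qquad X=\tfrac1{192}\left(\Theta-16b_2Z^2-12b_2^2ZU+b_2^3U^2\right),\qquad F_3=Z^2,\qquad G_3=X .$$ Let $U\in\mathcal{O}_K[x,y,z]$ be a ternary cubic form defining a smooth plane curve $\mathcal{C}_U$ over $K$, and suppose that its reduction $\{\widetilde U=0\}\subset\mathbb{P}^2_k$ contains a $k$-rational line $L$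 as a component of multiplicity one. Then there is an integer $\alpha$ such that $$\frac{\max(|F_3(x,y,z)|,|G_3(x,y,z)|)}{\max(|x|,|y|,|z|)^6}=|\pi|^{2\alpha}$$ for every $(x:y:z)\in\mathcal{C}_U(K)$ whose reduction lies on $L$ and is a smooth point of the curve $\{\widetilde U=0\}$. Moreover, if $L$ is the line $\{x=0\}$ then $\alpha$ is computed by the following algorithm, which always terminates and returns $\alpha$, whatever choices are made in step (iii). (i) Set $\alpha=0$. (ii) Replace $U$ by $\pi^{-1}U(\pi x,y,z)$ (which again has coefficients in $\mathcal{O}_K$) and let $\alpha=\alpha+1$. (iii) Write $U=f_0x^3+f_1(y,z)x^2+f_2(y,z)x+f_3(y,z)$ with $f_i$ a binary form of degree $i$. If $\widetilde{f_2}\mid\widetilde{f_3}$, choose $a,b\in\mathcal{O}_K$ with $f_3\equiv(ay+bz)f_2\pmod\pi$ (such $a,b$ exist), substitute $x\leftarrow x-ay-bz$, and go to step (ii). (iv) Return $\alpha$. -/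

import Mathlib

open MvPolynomial

/-! ### The ring of integers of a finite extension of `ℚ_[p]` -/

section RingOfIntegers

variable (p : ℕ) [Fact p.Prime] (K : Type*) [Field K] [Algebra ℚ_[p] K]
  [Algebra ℤ_[p] K] [IsScalarTower ℤ_[p] ℚ_[p] K]

theorem isIntegral_padicInt_of_spectralNorm_le_one [FiniteDimensional ℚ_[p] K] (x : K)
    (hx : spectralNorm ℚ_[p] K x ≤ 1) : IsIntegral ℤ_[p] x := by
  have hmon : (minpoly ℚ_[p] x).Monic := minpoly.monic (Algebra.IsIntegral.isIntegral x)
  have h := (spectralValue_le_one_iff hmon).1 hx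
  have hl : minpoly ℚ_[p] x ∈ Polynomial.lifts (algebraMap ℤ_[p] ℚ_[p]) := by
    rw [Polynomial.lifts_iff_coeff_lifts]
    intro n
    exact ⟨⟨(minpoly ℚ_[p] x).coeff n, h n⟩, rfl⟩
  obtain ⟨q, hq, -, hqm⟩ := Polynomial.lifts_and_degree_eq_and_monic hl hmon
  refine ⟨q, hqm, ?_⟩
  have h0 : Polynomial.aeval x (q.map (algebraMap ℤ_[p] ℚ_[p])) = 0 := by
    rw [hq]; exact minpoly.aeval _ _
  rwa [Polynomial.aeval_map_algebraMap] at h0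

instance integralClosure_padicInt_isFractionRing [FiniteDimensional ℚ_[p] K] :
    IsFractionRing (integralClosure ℤ_[p] K) K :=
  integralClosure.isFractionRing_of_finite_extension ℚ_[p] K

instance integralClosure_padicInt_isDiscreteValuationRing [FiniteDimensional ℚ_[p] K] :
    IsDiscreteValuationRing (integralClosure ℤ_[p] K) := by
  have hloc : ValuationRing (integralClosure ℤ_[p] K) := by
    rw [ValuationRing.iff_isInteger_or_isInteger (integralClosure ℤ_[p] K) K]
    intro x
    have key : ∀ y : K, spectralNorm ℚ_[p] K y ≤ 1 →
        IsLocalization.IsInteger (integralClosure ℤ_[p] K) y := fun y hy =>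
      ⟨⟨y, isIntegral_padicInt_of_spectralNorm_le_one p K y hy⟩, rfl⟩
    by_cases hx : spectralNorm ℚ_[p] K x ≤ 1
    · exact Or.inl (key x hx)
    · right
      apply key
      have hx1 : 1 < spectralNorm ℚ_[p] K x := not_le.1 hx
      have hx0 : x ≠ 0 := by
        rintro rfl
        rw [spectralNorm_zero] at hx1
        linarith
      have hm := map_mul (spectralMulAlgNorm ℚ_[p] K) x x⁻¹
      rw [mul_inv_cancel₀ hx0, map_one] at hm
      simp only [spectralMulAlgNorm_def] at hm
      have hn : 0 ≤ spectralNorm ℚ_[p] K x⁻¹ := spectralNorm_nonneg _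
      nlinarith
  have hded : IsDedekindDomain (integralClosure ℤ_[p] K) :=
    IsIntegralClosure.isDedekindDomain ℤ_[p] ℚ_[p] K _
  have hnf : ¬ IsField (integralClosure ℤ_[p] K) := by
    intro hf
    have hinj : Function.Injective (algebraMap ℤ_[p] (integralClosure ℤ_[p] K)) := by
      apply Function.Injective.of_comp (f := algebraMap (integralClosure ℤ_[p] K) K)
      rw [← RingHom.coe_comp, ← IsScalarTower.algebraMap_eq, IsScalarTower.algebraMap_eq ℤ_[p] ℚ_[p] K]
      exact (algebraMap ℚ_[p] K).injective.comp (IsFractionRing.injective ℤ_[p] ℚ_[p])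
    exact IsDiscreteValuationRing.not_isField ℤ_[p]
      (isField_of_isIntegral_of_isField hinj hf)
  exact ((IsDiscreteValuationRing.TFAE (integralClosure ℤ_[p] K) hnf).out 0 2).2 hded

end RingOfIntegers

/-! ### Ternary cubics: the polynomials `F₃` and `G₃` -/

namespace TernaryCubic

section Covariants

variable {F : Type*} [Field F]

/-- The coefficient of `x ^ r * y ^ s * z ^ t`. -/
noncomputable def cf {R : Type*} [CommSemiring R] (U : MvPolynomial (Fin 3) R) (r s t : ℕ) : R :=
  U.coeff (Finsupp.single 0 r + Finsupp.single 1 s + Finsupp.single 2 t)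

/-- The invariant `b₂ = a₁² + 4 a₂`, where `a₁ = m` and `a₂ = -(f j + g k + h i)` for
`U = a x³ + b y³ + c z³ + f y² z + g z² x + h x² y + i y z² + j z x² + k x y² + m x y z`. -/
noncomputable def b₂ (U : MvPolynomial (Fin 3) F) : F :=
  cf U 1 1 1 ^ 2 +
    4 * -(cf U 0 2 1 * cf U 2 0 1 + cf U 1 0 2 * cf U 1 2 0 + cf U 2 1 0 * cf U 0 1 2)

/-- The Hessian matrix of second partial derivatives. -/
noncomputable def hessMatrix (U : MvPolynomial (Fin 3) F) :
    Matrix (Fin 3) (Fin 3) (MvPolynomial (Fin 3) F) :=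
  Matrix.of fun r s => pderiv r (pderiv s U)

/-- The Hessian covariant `H = -(1/2) det (U_{rs})`. -/
noncomputable def hessian (U : MvPolynomial (Fin 3) F) : MvPolynomial (Fin 3) F :=
  C (-(1 / 2)) * (hessMatrix U).det

/-- The covariant `Θ`: one third of the determinant of the Hessian matrix of `U` bordered by the
gradient of `H`. -/
noncomputable def theta (U : MvPolynomial (Fin 3) F) : MvPolynomial (Fin 3) F :=
  C (1 / 3) *
    (Matrix.fromBlocks (hessMatrix U)
      (Matrix.of fun r (_ : Fin 1) => pderiv r (hessian U))
      (Matrix.of fun (_ : Fin 1) s => pderiv s (hessian U)) 0).det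

/-- `Z = (H + b₂ U) / 4`. -/
noncomputable def covZ (U : MvPolynomial (Fin 3) F) : MvPolynomial (Fin 3) F :=
  C (1 / 4) * (hessian U + C (b₂ U) * U)

/-- `X = (Θ - 16 b₂ Z² - 12 b₂² Z U + b₂³ U²) / 192`. -/
noncomputable def covX (U : MvPolynomial (Fin 3) F) : MvPolynomial (Fin 3) F :=
  C (1 / 192) * (theta U - C (16 * b₂ U) * covZ U ^ 2 - C (12 * b₂ U ^ 2) * covZ U * U
    + C (b₂ U ^ 3) * U ^ 2)

/-- `F₃ = Z²`. -/
noncomputable def F₃ (U : MvPolynomial (Fin 3) F) : MvPolynomial (Fin 3) F := covZ U ^ 2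

/-- `G₃ = X`. -/
noncomputable def G₃ (U : MvPolynomial (Fin 3) F) : MvPolynomial (Fin 3) F := covX U

/-- Jacobian criterion at a point (given by homogeneous coordinates `q`, with values in an
`F`-algebra) of the plane curve `U = 0`. -/
def IsSmoothPoint {L : Type*} [Field L] [Algebra F L] (U : MvPolynomial (Fin 3) F)
    (q : Fin 3 → L) : Prop :=
  q ≠ 0 ∧ aeval q U = 0 ∧ ∃ i, aeval q (pderiv i U) ≠ 0

/-- The cubic form `U` defines a smooth plane curve (necessarily of genus one): every point over
the algebraic closure is smooth. -/
def IsNonsingular (U : MvPolynomial (Fin 3) F) : Prop :=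
  ∀ q : Fin 3 → AlgebraicClosure F, q ≠ 0 → aeval q U = 0 → IsSmoothPoint U q

end Covariants

/-! ### Reduction and absolute value over a discrete valuation ring -/

section DVR

variable {O : Type*} [CommRing O] [IsDomain O] [IsDiscreteValuationRing O]

/-- The absolute value `|x| = c ^ (-v x)` on the fraction field `K` of the discrete valuation
ring `O`, where `v` is the normalised valuation, and `|0| = 0`. (The multiplicative valuation of
Mathlib is `exp (-v x)`.) -/
noncomputable def absVal (O : Type*) [CommRing O] [IsDomain O] [IsDiscreteValuationRing O]
    {K : Type*} [Field K] [Algebra O K] [IsFractionRing O K] (c : ℝ) (x : K) : ℝ :=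
  open Classical in
  if x = 0 then 0
  else c ^ (WithZero.log ((IsDiscreteValuationRing.maximalIdeal O).valuation K x) : ℤ)

/-- The reduction of a form modulo the maximal ideal. -/
noncomputable def red {σ : Type*} (U : MvPolynomial σ O) :
    MvPolynomial σ (IsLocalRing.ResidueField O) :=
  map (IsLocalRing.residue O) U

/-- `q` is a vector of homogeneous coordinates of the reduction of the point with homogeneous
coordinates `x`: some multiple of `x` has entries in `O` and reduces to the nonzero vector `q`. -/
def ReducesTo {K : Type*} [Field K] [Algebra O K] (x : Fin 3 → K)
    (q : Fin 3 → IsLocalRing.ResidueField O) : Prop :=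
  q ≠ 0 ∧ ∃ c : K, c ≠ 0 ∧ ∃ u : Fin 3 → O,
    (∀ i, algebraMap O K (u i) = c * x i) ∧ ∀ i, IsLocalRing.residue O (u i) = q i

/-- The line `ℓ = 0` (`ℓ` a nonzero linear form) is a component of multiplicity one of the
curve `V = 0`. -/
def IsLineOfMultiplicityOne {k : Type*} [Field k] (V ℓ : MvPolynomial (Fin 3) k) : Prop :=
  ℓ ≠ 0 ∧ ℓ.IsHomogeneous 1 ∧ ℓ ∣ V ∧ ¬ ℓ ^ 2 ∣ V

/-- The quantity `max (|F₃(x)|, |G₃(x)|) / max (|x₀|, |x₁|, |x₂|) ^ 6`. -/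
noncomputable def localRatio {K : Type*} [Field K] [Algebra O K] [IsFractionRing O K] (c : ℝ)
    (U : MvPolynomial (Fin 3) O) (x : Fin 3 → K) : ℝ :=
  max (absVal O c (eval x (F₃ (map (algebraMap O K) U))))
      (absVal O c (eval x (G₃ (map (algebraMap O K) U)))) /
    max (max (absVal O c (x 0)) (absVal O c (x 1))) (absVal O c (x 2)) ^ 6

/-! ### The iterative substitution algorithm -/

/-- The coefficient of `x ^ i`, a polynomial in the two variables `y, z`; for a cubic form
`U = f₀ x³ + f₁(y,z) x² + f₂(y,z) x + f₃(y,z)` this is `f_{3-i}`. -/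
noncomputable def xCoeff (U : MvPolynomial (Fin 3) O) (i : ℕ) : MvPolynomial (Fin 2) O :=
  (finSuccEquiv O 2 U).coeff i

/-- `f₂(y,z)`. -/
noncomputable def f₂ (U : MvPolynomial (Fin 3) O) : MvPolynomial (Fin 2) O := xCoeff U 1

/-- `f₃(y,z)`. -/
noncomputable def f₃ (U : MvPolynomial (Fin 3) O) : MvPolynomial (Fin 2) O := xCoeff U 0

/-- `U(π x, y, z)`. -/
noncomputable def scaleX (π : O) (U : MvPolynomial (Fin 3) O) : MvPolynomial (Fin 3) O :=
  aeval ![C π * X 0, X 1, X 2] U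

/-- `U(x - a y - b z, y, z)`. -/
noncomputable def shear (a b : O) (U : MvPolynomial (Fin 3) O) : MvPolynomial (Fin 3) O :=
  aeval ![X 0 - C a * X 1 - C b * X 2, X 1, X 2] U

/-- States of the algorithm: the current cubic and counter on entering step (ii), the same on
entering step (iii), or the returned value. -/
inductive AlgState (O : Type*) [CommRing O] : Type _
  | atStep2 (U : MvPolynomial (Fin 3) O) (α : ℤ)
  | atStep3 (U : MvPolynomial (Fin 3) O) (α : ℤ)
  | returned (α : ℤ)

/-- One step of the algorithm:
* step (ii) replaces `U` by `V = π⁻¹ U(π x, y, z)` and `α` by `α + 1`;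
* step (iii), if the reduction of `f₂` divides that of `f₃`, chooses some `a, b ∈ O` with
  `f₃ ≡ (a y + b z) f₂` modulo `π`, substitutes `x ← x - a y - b z` and goes to step (ii);
* step (iii) otherwise returns `α`. -/
inductive AlgStep (π : O) : AlgState O → AlgState O → Prop
  | scale (U V : MvPolynomial (Fin 3) O) (α : ℤ) (h : C π * V = scaleX π U) :
      AlgStep π (.atStep2 U α) (.atStep3 V (α + 1))
  | subst (U : MvPolynomial (Fin 3) O) (α : ℤ) (a b : O) (hdvd : red (f₂ U) ∣ red (f₃ U))
      (h : red (f₃ U) = red ((C a * X 0 + C b * X 1) * f₂ U)) :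
      AlgStep π (.atStep3 U α) (.atStep2 (shear a b U) α)
  | halt (U : MvPolynomial (Fin 3) O) (α : ℤ) (h : ¬ red (f₂ U) ∣ red (f₃ U)) :
      AlgStep π (.atStep3 U α) (.returned α)

/-- The algorithm, started on `U` with counter `0`, computes `α`: whatever choices of `a, b` are
made, the run terminates (there is no infinite run), it never gets stuck, and the value returned
is `α`. -/
def AlgComputes (π : O) (U : MvPolynomial (Fin 3) O) (α : ℤ) : Prop :=
  Acc (fun t s => AlgStep π s t) (.atStep2 U 0) ∧
    ∀ s, Relation.ReflTransGen (AlgStep π) (.atStep2 U 0) s →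
      (∃ t, AlgStep π s t) ∨ s = .returned α

end DVR

end TernaryCubic

/-! The exponent α is the largest n such that U vanishes modulo π^n on some line x + a y + b z = 0
with a, b ≡ 0 (mod π) (`HasLineMod`), once L has been moved to x = 0. The case n = 1 holds because L
lies on the reduction. The n are bounded: otherwise, the unit ball of K being compact, a limit of
such lines would lie on the curve, contradicting smoothness (`exists_not_hasLineMod`).

The ratio. Under U ↦ t·(U ∘ g), on the curve Z and X have weights t³(det g)² and t⁸(det g)⁶, except
that X also loses r·Z² when b₂ changes by 12 r beyond its own weight. For integral r this does not
affect max(|Z²|, |X|), so if |t det g| = 1 the maximum is multiplied by |t|² (`covMax_linSubst`).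
Take W = π^(-α) U(π^α x - a y - b z, y, z). A smooth point on L is a simple root in x, hence
congruent modulo π^α to the point of the line with the same y, z; so it lifts to an integral point
of W, still with unit x-derivative. By maximality of α no line x + a' y + b' z = 0 lies on the
reduction of W. With the point at (0:0:1) and its tangent at x = 0, the values are Z = f g² and X =
g⁵(b² g - b f m + f² k), where g is a unit and f, b are not both divisible by π; so the maximum is 1
for W (`covMax_eq_one`) and |π|^(2α) for U (`covMax_eq_absVal_pow`).

The algorithm. At counter n the current cubic is π^(-n) U(π^n x - a y - b z, y, z) for a line as
above. For n ≥ 1 the divisibility test asks whether the line can be refined modulo π^(n+1). Viewing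
U as a polynomial in x over O[y, z], the line is a simple root modulo π because f₂ is nonzero there;
hence its class modulo π^n is unique, no choice of a, b leads astray, and the run stops exactly at α
(`exists_C_dvd_onLine`, `AlgInvariant.step`). -/

namespace TernaryCubic

/-! ### Linear substitutions and the chain rule -/

section Substitution

variable {R : Type*} [CommRing R]

/-- The linear substitution `U ↦ U ∘ g`. -/
noncomputable def linSubst (g : Matrix (Fin 3) (Fin 3) R) :
    MvPolynomial (Fin 3) R →ₐ[R] MvPolynomial (Fin 3) R :=
  aeval fun i => ∑ j, C (g i j) * X j

theorem eval_linSubst (g : Matrix (Fin 3) (Fin 3) R) (v : Fin 3 → R)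
    (U : MvPolynomial (Fin 3) R) : eval v (linSubst g U) = eval (g.mulVec v) U := by
  have : (eval v).comp (linSubst g : _ →ₐ[R] _).toRingHom = eval (g.mulVec v) := by
    apply MvPolynomial.ringHom_ext
    · intro r; simp [linSubst]
    · intro i; simp [linSubst, Matrix.mulVec, dotProduct]
  exact congrArg (fun φ => φ U) this

theorem isHomogeneous_linSubst (g : Matrix (Fin 3) (Fin 3) R) {U : MvPolynomial (Fin 3) R} {n : ℕ}
    (hU : U.IsHomogeneous n) : (linSubst g U).IsHomogeneous n := by
  have := hU.aeval (fun i => ∑ j, C (g i j) * X j) (n := 1)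
    (fun i => IsHomogeneous.sum _ _ _ fun j _ => isHomogeneous_C_mul_X _ _)
  rwa [one_mul] at this

theorem linSubst_C_mul (g : Matrix (Fin 3) (Fin 3) R) (a : R) (U : MvPolynomial (Fin 3) R) :
    linSubst g (C a * U) = C a * linSubst g U := by
  rw [map_mul]
  simp [linSubst]

theorem linSubst_linSubst (g g' : Matrix (Fin 3) (Fin 3) R) (U : MvPolynomial (Fin 3) R) :
    linSubst g (linSubst g' U) = linSubst (g' * g) U := by
  have : (linSubst g).comp (linSubst g') = linSubst (g' * g) := by
    apply MvPolynomial.algHom_ext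
    intro i
    simp only [linSubst, AlgHom.comp_apply, aeval_X, map_sum, map_mul, algHom_C,
      MvPolynomial.algebraMap_eq, Matrix.mul_apply, Finset.mul_sum, Finset.sum_mul]
    rw [Finset.sum_comm]
    simp only [mul_assoc]
  exact congrArg (fun φ => φ U) this

theorem linSubst_one (U : MvPolynomial (Fin 3) R) : linSubst 1 U = U := by
  have : linSubst (1 : Matrix (Fin 3) (Fin 3) R) = AlgHom.id R _ := by
    apply MvPolynomial.algHom_ext
    intro i
    simp [linSubst, Matrix.one_apply]
  exact congrArg (fun φ => φ U) this

theorem map_linSubst {S : Type*} [CommRing S] (φ : R →+* S) (g : Matrix (Fin 3) (Fin 3) R)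
    (U : MvPolynomial (Fin 3) R) : map φ (linSubst g U) = linSubst (g.map φ) (map φ U) := by
  have : (map φ).comp (linSubst g : _ →ₐ[R] _).toRingHom =
      (linSubst (g.map φ) : _ →ₐ[S] _).toRingHom.comp (map φ) := by
    apply MvPolynomial.ringHom_ext
    · intro r; simp [linSubst]
    · intro i; simp [linSubst]
  exact congrArg (fun φ => φ U) this

theorem pderiv_linSubst (g : Matrix (Fin 3) (Fin 3) R) (j : Fin 3) (U : MvPolynomial (Fin 3) R) :
    pderiv j (linSubst g U) = ∑ i, C (g i j) * linSubst g (pderiv i U) := by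
  induction U using MvPolynomial.induction_on with
  | C r => simp [linSubst]
  | add p q hp hq => simp only [map_add, hp, hq, mul_add, Finset.sum_add_distrib]
  | mul_X p n hp =>
    have h1 : pderiv j (linSubst g (X n)) = C (g n j) := by
      simp [linSubst, pderiv_X, Pi.single_apply]
    simp only [map_mul, Derivation.leibniz, smul_eq_mul, hp, h1, pderiv_X, map_add, mul_add,
      Finset.sum_add_distrib]
    congr 1
    · rw [Finset.sum_eq_single n]
      · simp; ring
      · intro b _ hb; simp [hb.symm]
      · simp
    · rw [Finset.mul_sum]
      exact Finset.sum_congr rfl fun i _ => by ring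

end Substitution

/-! ### Weights of H, Θ, Z and X -/

section Covariance

variable {F : Type*} [Field F]

theorem hessMatrix_linSubst (t : F) (g : Matrix (Fin 3) (Fin 3) F) (U : MvPolynomial (Fin 3) F) :
    hessMatrix (C t * linSubst g U) =
      (C t : MvPolynomial (Fin 3) F) •
        ((g.map C).transpose * (hessMatrix U).map (linSubst g) * g.map C) := by
  ext1 r s
  simp only [hessMatrix, Matrix.of_apply, pderiv_C_mul, pderiv_linSubst, map_sum, Matrix.smul_apply,
    Matrix.mul_apply, Matrix.transpose_apply, Matrix.map_apply, smul_eq_mul]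
  congr 1
  exact Finset.sum_congr rfl fun i _ => by
    rw [Finset.mul_sum, Finset.sum_mul]
    exact Finset.sum_congr rfl fun j _ => by ring

theorem det_map_linSubst {n : Type*} [Fintype n] [DecidableEq n] (g : Matrix (Fin 3) (Fin 3) F)
    (M : Matrix n n (MvPolynomial (Fin 3) F)) :
    (M.map (linSubst g)).det = linSubst g M.det :=
  ((linSubst g).map_det M).symm

theorem det_map_C {n : Type*} [Fintype n] [DecidableEq n] (g : Matrix n n F) :
    (g.map (C : F → MvPolynomial (Fin 3) F)).det = C g.det :=
  ((C : F →+* MvPolynomial (Fin 3) F).map_det g).symm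

theorem hessian_linSubst (t : F) (g : Matrix (Fin 3) (Fin 3) F) (U : MvPolynomial (Fin 3) F) :
    hessian (C t * linSubst g U) = C (t ^ 3 * g.det ^ 2) * linSubst g (hessian U) := by
  rw [hessian, hessMatrix_linSubst, Matrix.det_smul, Matrix.det_mul, Matrix.det_mul,
    Matrix.det_transpose, det_map_linSubst, det_map_C, hessian, linSubst_C_mul]
  simp only [Fintype.card_fin, map_mul, map_pow]
  ring

theorem theta_linSubst (t : F) (g : Matrix (Fin 3) (Fin 3) F) (U : MvPolynomial (Fin 3) F) :
    theta (C t * linSubst g U) = C (t ^ 8 * g.det ^ 6) * linSubst g (theta U) := by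
  -- The gradient of H carries t³(det g)² and one factor g. The left factor already contributes t to
  -- the upper border, so the right corner needs only t²(det g)².
  have key : Matrix.fromBlocks (hessMatrix (C t * linSubst g U))
        (Matrix.of fun r (_ : Fin 1) => pderiv r (hessian (C t * linSubst g U)))
        (Matrix.of fun (_ : Fin 1) s => pderiv s (hessian (C t * linSubst g U))) 0 =
      Matrix.fromBlocks ((C t : MvPolynomial (Fin 3) F) • (g.map C).transpose) 0 0
          ((C (t ^ 3 * g.det ^ 2) : MvPolynomial (Fin 3) F) •
            (1 : Matrix (Fin 1) (Fin 1) (MvPolynomial (Fin 3) F))) *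
        (Matrix.fromBlocks (hessMatrix U)
          (Matrix.of fun r (_ : Fin 1) => pderiv r (hessian U))
          (Matrix.of fun (_ : Fin 1) s => pderiv s (hessian U)) 0).map (linSubst g) *
        Matrix.fromBlocks (g.map C) 0 0
          ((C (t ^ 2 * g.det ^ 2) : MvPolynomial (Fin 3) F) •
            (1 : Matrix (Fin 1) (Fin 1) (MvPolynomial (Fin 3) F))) := by
    rw [Matrix.fromBlocks_map, Matrix.fromBlocks_multiply, Matrix.fromBlocks_multiply,
      hessMatrix_linSubst, hessian_linSubst]
    congr 1
    · simp
    · ext1 r s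
      simp only [Matrix.of_apply, pderiv_C_mul, pderiv_linSubst]
      simp only [Matrix.zero_mul, Matrix.of_apply, add_zero, Matrix.mul_zero, zero_add,
        Matrix.smul_mul, Matrix.mul_smul, Matrix.mul_one,
        Matrix.smul_apply, Matrix.mul_apply, Matrix.transpose_apply, Matrix.map_apply, smul_eq_mul,
        map_mul, map_pow]
      ring
    · ext1 r s
      simp only [Matrix.of_apply, pderiv_C_mul, pderiv_linSubst]
      simp only [Matrix.zero_mul, Matrix.of_apply, add_zero, Matrix.mul_zero, zero_add,
        Matrix.smul_mul, Matrix.one_mul,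
        Matrix.smul_apply, Matrix.mul_apply, Matrix.map_apply, smul_eq_mul, mul_comm]
    · ext r s
      simp
  rw [theta, key, Matrix.det_mul, Matrix.det_mul, Matrix.det_fromBlocks_zero₂₁,
    Matrix.det_fromBlocks_zero₂₁, det_map_linSubst, theta, linSubst_C_mul,
    Matrix.det_smul, Matrix.det_smul, Matrix.det_smul,
    Matrix.det_transpose, det_map_C]
  simp only [Fintype.card_fin, map_mul, map_pow, Matrix.det_one]
  ring

variable [CharZero F]

theorem eval_covZ_linSubst (t : F) (g : Matrix (Fin 3) (Fin 3) F) (U : MvPolynomial (Fin 3) F)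
    (v : Fin 3 → F) (hv : eval (g.mulVec v) U = 0) :
    eval v (covZ (C t * linSubst g U)) = t ^ 3 * g.det ^ 2 * eval (g.mulVec v) (covZ U) := by
  simp only [covZ, hessian_linSubst, map_mul, map_add, eval_C, eval_linSubst, hv]
  ring

/-- On the curve X = (Θ - 16 b₂ Z²)/192, and 192 = 16 · 12, so a change of b₂ by 12 r subtracts
exactly r Z². -/
theorem eval_covX_linSubst (t : F) (g : Matrix (Fin 3) (Fin 3) F) (U : MvPolynomial (Fin 3) F)
    (v : Fin 3 → F) (hv : eval (g.mulVec v) U = 0) (r : F)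
    (hr : b₂ (C t * linSubst g U) = (t * g.det) ^ 2 * b₂ U + 12 * r) :
    eval v (covX (C t * linSubst g U)) =
      t ^ 8 * g.det ^ 6 * eval (g.mulVec v) (covX U) -
        r * eval v (covZ (C t * linSubst g U)) ^ 2 := by
  have hZ := eval_covZ_linSubst t g U v hv
  simp only [covX, map_mul, map_add, map_sub, map_pow, eval_C, hZ, theta_linSubst, eval_linSubst,
    hv, hr]
  field_simp
  ring

end Covariance

/-! ### Ternary cubics in coordinates -/

section Cubic

variable {R : Type*} [CommRing R]

/-- The ternary cubic with the given coefficients. -/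
noncomputable def cubic (a b c f g h i j k m : R) : MvPolynomial (Fin 3) R :=
  C a * X 0 ^ 3 + C b * X 1 ^ 3 + C c * X 2 ^ 3 + C f * (X 1 ^ 2 * X 2) + C g * (X 2 ^ 2 * X 0) +
    C h * (X 0 ^ 2 * X 1) + C i * (X 1 * X 2 ^ 2) + C j * (X 2 * X 0 ^ 2) + C k * (X 0 * X 1 ^ 2) +
    C m * (X 0 * X 1 * X 2)

theorem cf_add (U V : MvPolynomial (Fin 3) R) (r s t : ℕ) :
    cf (U + V) r s t = cf U r s t + cf V r s t :=
  coeff_add _ _ _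

theorem cf_C_mul (a : R) (U : MvPolynomial (Fin 3) R) (r s t : ℕ) :
    cf (C a * U) r s t = a * cf U r s t :=
  coeff_C_mul _ _ _

theorem cf_term (a : R) (p q w r s t : ℕ) :
    cf (C a * (X 0 ^ p * X 1 ^ q * X 2 ^ w)) r s t = if p = r ∧ q = s ∧ w = t then a else 0 := by
  have h : (X 0 ^ p * X 1 ^ q * X 2 ^ w : MvPolynomial (Fin 3) R) =
      monomial (Finsupp.single 0 p + Finsupp.single 1 q + Finsupp.single 2 w) 1 := by
    simp [X_pow_eq_monomial, monomial_mul]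
  rw [cf, coeff_C_mul, h, coeff_monomial, mul_ite, mul_one, mul_zero]
  congr 1
  rw [eq_iff_iff]
  constructor
  · intro e
    refine ⟨?_, ?_, ?_⟩
    · simpa using DFunLike.congr_fun e 0
    · simpa using DFunLike.congr_fun e 1
    · simpa using DFunLike.congr_fun e 2
  · rintro ⟨rfl, rfl, rfl⟩
    rfl

theorem cf_cubic (a b c f g h i j k m : R) (r s t : ℕ) :
    cf (cubic a b c f g h i j k m) r s t =
      (if 3 = r ∧ 0 = s ∧ 0 = t then a else 0) + (if 0 = r ∧ 3 = s ∧ 0 = t then b else 0) +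
      (if 0 = r ∧ 0 = s ∧ 3 = t then c else 0) + (if 0 = r ∧ 2 = s ∧ 1 = t then f else 0) +
      (if 1 = r ∧ 0 = s ∧ 2 = t then g else 0) + (if 2 = r ∧ 1 = s ∧ 0 = t then h else 0) +
      (if 0 = r ∧ 1 = s ∧ 2 = t then i else 0) + (if 2 = r ∧ 0 = s ∧ 1 = t then j else 0) +
      (if 1 = r ∧ 2 = s ∧ 0 = t then k else 0) + (if 1 = r ∧ 1 = s ∧ 1 = t then m else 0) := by
  have h : cubic a b c f g h i j k m =
      C a * (X 0 ^ 3 * X 1 ^ 0 * X 2 ^ 0) + C b * (X 0 ^ 0 * X 1 ^ 3 * X 2 ^ 0) +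
      C c * (X 0 ^ 0 * X 1 ^ 0 * X 2 ^ 3) + C f * (X 0 ^ 0 * X 1 ^ 2 * X 2 ^ 1) +
      C g * (X 0 ^ 1 * X 1 ^ 0 * X 2 ^ 2) + C h * (X 0 ^ 2 * X 1 ^ 1 * X 2 ^ 0) +
      C i * (X 0 ^ 0 * X 1 ^ 1 * X 2 ^ 2) + C j * (X 0 ^ 2 * X 1 ^ 0 * X 2 ^ 1) +
      C k * (X 0 ^ 1 * X 1 ^ 2 * X 2 ^ 0) + C m * (X 0 ^ 1 * X 1 ^ 1 * X 2 ^ 1) := by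
    simp only [cubic, pow_zero, pow_one, mul_one, one_mul]
    ring
  rw [h]
  simp only [cf_add, cf_term]

theorem isHomogeneous_cubic (a b c f g h i j k m : R) :
    (cubic a b c f g h i j k m).IsHomogeneous 3 := by
  have hX (i : Fin 3) (n : ℕ) : (X i ^ n : MvPolynomial (Fin 3) R).IsHomogeneous n :=
    isHomogeneous_X_pow i n
  have h1 (i : Fin 3) : (X i : MvPolynomial (Fin 3) R).IsHomogeneous 1 := isHomogeneous_X R i
  unfold cubic
  refine IsHomogeneous.add (IsHomogeneous.add (IsHomogeneous.add (IsHomogeneous.add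
    (IsHomogeneous.add (IsHomogeneous.add (IsHomogeneous.add (IsHomogeneous.add
    (IsHomogeneous.add ?_ ?_) ?_) ?_) ?_) ?_) ?_) ?_) ?_) ?_ <;> refine IsHomogeneous.C_mul ?_ _
  · exact hX 0 3
  · exact hX 1 3
  · exact hX 2 3
  · exact (hX 1 2).mul (h1 2)
  · exact (hX 2 2).mul (h1 0)
  · exact (hX 0 2).mul (h1 1)
  · exact (h1 1).mul (hX 2 2)
  · exact (h1 2).mul (hX 0 2)
  · exact (h1 0).mul (hX 1 2)
  · exact ((h1 0).mul (h1 1)).mul (h1 2)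

theorem eq_cubic_of_isHomogeneous {U : MvPolynomial (Fin 3) R} (hU : U.IsHomogeneous 3) :
    U = cubic (cf U 3 0 0) (cf U 0 3 0) (cf U 0 0 3) (cf U 0 2 1) (cf U 1 0 2) (cf U 2 1 0)
      (cf U 0 1 2) (cf U 2 0 1) (cf U 1 2 0) (cf U 1 1 1) := by
  ext d
  by_cases hd : d.degree = 3
  · obtain ⟨r, s, t, rfl⟩ : ∃ r s t, d = Finsupp.single 0 r + Finsupp.single 1 s +
        Finsupp.single 2 t := by
      refine ⟨d 0, d 1, d 2, ?_⟩
      ext i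
      fin_cases i <;> simp
    have hd' : r + s + t = 3 := by simpa [Finsupp.degree_single] using hd
    change cf U r s t = cf (cubic _ _ _ _ _ _ _ _ _ _) r s t
    rw [cf_cubic]
    have hr : r ≤ 3 := by omega
    have hs : s ≤ 3 := by omega
    obtain rfl : t = 3 - r - s := by omega
    interval_cases r <;> interval_cases s <;> first | omega | simp
  · rw [hU.coeff_eq_zero hd, (isHomogeneous_cubic _ _ _ _ _ _ _ _ _ _).coeff_eq_zero hd]

theorem exists_eq_cubic {U : MvPolynomial (Fin 3) R} (hU : U.IsHomogeneous 3) :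
    ∃ a b c f g h i j k m, U = cubic a b c f g h i j k m :=
  ⟨_, _, _, _, _, _, _, _, _, _, eq_cubic_of_isHomogeneous hU⟩

theorem map_cubic {S : Type*} [CommRing S] (φ : R →+* S) (a b c f g h i j k m : R) :
    map φ (cubic a b c f g h i j k m) =
      cubic (φ a) (φ b) (φ c) (φ f) (φ g) (φ h) (φ i) (φ j) (φ k) (φ m) := by
  simp [cubic]

theorem linSubst_unipotent_cubic (s t w a b c f g h i j k m : R) :
    linSubst !![1, s, t; 0, 1, w; 0, 0, 1] (cubic a b c f g h i j k m) =
      cubic a (a * s ^ 3 + b + h * s ^ 2 + k * s)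
        (a * t ^ 3 + b * w ^ 3 + c + f * w ^ 2 + g * t + h * t ^ 2 * w + i * w + j * t ^ 2 +
          k * t * w ^ 2 + m * t * w)
        (3 * a * s ^ 2 * t + 3 * b * w + f + h * s ^ 2 * w + 2 * h * s * t + j * s ^ 2 +
          2 * k * s * w + k * t + m * s)
        (3 * a * t ^ 2 + g + 2 * h * t * w + 2 * j * t + k * w ^ 2 + m * w)
        (3 * a * s + h)
        (3 * a * s * t ^ 2 + 3 * b * w ^ 2 + 2 * f * w + g * s + 2 * h * s * t * w + h * t ^ 2 + i +
          2 * j * s * t + k * s * w ^ 2 + 2 * k * t * w + m * s * w + m * t)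
        (3 * a * t + h * w + j)
        (3 * a * s ^ 2 + 2 * h * s + k)
        (6 * a * s * t + 2 * h * s * w + 2 * h * t + 2 * j * s + 2 * k * w + m) := by
  have hn (n : ℕ) [n.AtLeastTwo] : (C (OfNat.ofNat n : R) : MvPolynomial (Fin 3) R) =
    OfNat.ofNat n := map_ofNat C n
  simp only [linSubst, cubic, map_add, map_mul, map_pow, algHom_C, MvPolynomial.algebraMap_eq,
    aeval_X, Fin.sum_univ_three, Matrix.of_apply, Matrix.cons_val', Matrix.cons_val_zero,
    Matrix.cons_val_one, Matrix.cons_val, Matrix.cons_val_fin_one, map_zero, map_one, hn]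
  ring

theorem linSubst_diagonal_cubic (d a b c f g h i j k m : R) :
    linSubst !![d, 0, 0; 0, 1, 0; 0, 0, 1] (cubic a b c f g h i j k m) =
      cubic (d ^ 3 * a) b c f (d * g) (d ^ 2 * h) i (d ^ 2 * j) (d * k) (d * m) := by
  simp only [linSubst, cubic, map_add, map_mul, map_pow, algHom_C, MvPolynomial.algebraMap_eq,
    aeval_X, Fin.sum_univ_three, Matrix.of_apply, Matrix.cons_val', Matrix.cons_val_zero,
    Matrix.cons_val_one, Matrix.cons_val, Matrix.cons_val_fin_one, map_zero, map_one]
  ring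

theorem linSubst_scalar_cubic (d a b c f g h i j k m : R) :
    linSubst !![d, 0, 0; 0, d, 0; 0, 0, d] (cubic a b c f g h i j k m) =
      C (d ^ 3) * cubic a b c f g h i j k m := by
  simp only [linSubst, cubic, map_add, map_mul, map_pow, algHom_C, MvPolynomial.algebraMap_eq,
    aeval_X, Fin.sum_univ_three, Matrix.of_apply, Matrix.cons_val', Matrix.cons_val_zero,
    Matrix.cons_val_one, Matrix.cons_val, Matrix.cons_val_fin_one, map_zero]
  ring

theorem linSubst_swap01_cubic (a b c f g h i j k m : R) :
    linSubst !![0, 1, 0; 1, 0, 0; 0, 0, 1] (cubic a b c f g h i j k m) =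
      cubic b a c j i k g f h m := by
  simp only [linSubst, cubic, map_add, map_mul, map_pow, algHom_C, MvPolynomial.algebraMap_eq,
    aeval_X, Fin.sum_univ_three, Matrix.of_apply, Matrix.cons_val', Matrix.cons_val_zero,
    Matrix.cons_val_one, Matrix.cons_val, Matrix.cons_val_fin_one, map_zero, map_one]
  ring

theorem linSubst_swap02_cubic (a b c f g h i j k m : R) :
    linSubst !![0, 0, 1; 0, 1, 0; 1, 0, 0] (cubic a b c f g h i j k m) =
      cubic c b a k j i h g f m := by
  simp only [linSubst, cubic, map_add, map_mul, map_pow, algHom_C, MvPolynomial.algebraMap_eq,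
    aeval_X, Fin.sum_univ_three, Matrix.of_apply, Matrix.cons_val', Matrix.cons_val_zero,
    Matrix.cons_val_one, Matrix.cons_val, Matrix.cons_val_fin_one, map_zero, map_one]
  ring

theorem linSubst_swap12_cubic (a b c f g h i j k m : R) :
    linSubst !![1, 0, 0; 0, 0, 1; 0, 1, 0] (cubic a b c f g h i j k m) =
      cubic a c b i k j f h g m := by
  simp only [linSubst, cubic, map_add, map_mul, map_pow, algHom_C, MvPolynomial.algebraMap_eq,
    aeval_X, Fin.sum_univ_three, Matrix.of_apply, Matrix.cons_val', Matrix.cons_val_zero,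
    Matrix.cons_val_one, Matrix.cons_val, Matrix.cons_val_fin_one, map_zero, map_one]
  ring

end Cubic

/-! ### The behaviour of b₂ under substitutions -/

section BTwo

variable {F : Type*} [Field F]

theorem b₂_cubic (a b c f g h i j k m : F) :
    b₂ (cubic a b c f g h i j k m) = m ^ 2 - 4 * (f * j + g * k + h * i) := by
  simp only [b₂, cf_cubic]
  norm_num
  ring

theorem b₂_C_mul (t : F) (U : MvPolynomial (Fin 3) F) : b₂ (C t * U) = t ^ 2 * b₂ U := by
  simp only [b₂, cf_C_mul]
  ring

/-- Although b₂ is not invariant, its change is 12 times a polynomial with integer coefficients.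
Taking r in R rather than in F is what later makes the correction to X integral. -/
theorem b₂_unipotent {R : Type*} [CommRing R] (φ : R →+* F) (s t w : R)
    {U : MvPolynomial (Fin 3) R} (hU : U.IsHomogeneous 3) :
    ∃ r, b₂ (map φ (linSubst !![1, s, t; 0, 1, w; 0, 0, 1] U)) = b₂ (map φ U) + 12 * φ r := by
  obtain ⟨a, b, c, f, g, h, i, j, k, m, rfl⟩ := exists_eq_cubic hU
  -- The witness is the difference of the two values of b₂, expanded in the ten coefficients and
  -- divided by 12.
  refine ⟨-6 * a ^ 2 * s ^ 2 * t ^ 2 - 3 * a * b * s * w ^ 2 - 3 * a * b * t * w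
    - 2 * a * f * s * w - a * f * t - 2 * a * g * s ^ 2 - 4 * a * h * s ^ 2 * t * w
    - 4 * a * h * s * t ^ 2 - a * i * s - 4 * a * j * s ^ 2 * t - 2 * a * k * s ^ 2 * w ^ 2
    - 2 * a * k * s * t * w - 2 * a * k * t ^ 2 - 2 * a * m * s ^ 2 * w - a * m * s * t
    - 2 * b * h * w ^ 2 - b * j * w - f * h * w - g * h * s - 2 * h ^ 2 * s * t * w
    - 2 * h * j * s * t - h * k * s * w ^ 2 - h * k * t * w - h * m * s * w - j * k * t, ?_⟩
  rw [linSubst_unipotent_cubic, map_cubic, map_cubic, b₂_cubic, b₂_cubic]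
  simp only [map_add, map_sub, map_mul, map_pow, map_ofNat, map_neg]
  ring

theorem b₂_diagonal (d : F) {U : MvPolynomial (Fin 3) F} (hU : U.IsHomogeneous 3) :
    b₂ (linSubst !![d, 0, 0; 0, 1, 0; 0, 0, 1] U) = d ^ 2 * b₂ U := by
  obtain ⟨a, b, c, f, g, h, i, j, k, m, rfl⟩ := exists_eq_cubic hU
  rw [linSubst_diagonal_cubic, b₂_cubic, b₂_cubic]
  ring

theorem b₂_swap01 {U : MvPolynomial (Fin 3) F} (hU : U.IsHomogeneous 3) :
    b₂ (linSubst !![0, 1, 0; 1, 0, 0; 0, 0, 1] U) = b₂ U := by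
  obtain ⟨a, b, c, f, g, h, i, j, k, m, rfl⟩ := exists_eq_cubic hU
  rw [linSubst_swap01_cubic, b₂_cubic, b₂_cubic]
  ring

theorem b₂_swap02 {U : MvPolynomial (Fin 3) F} (hU : U.IsHomogeneous 3) :
    b₂ (linSubst !![0, 0, 1; 0, 1, 0; 1, 0, 0] U) = b₂ U := by
  obtain ⟨a, b, c, f, g, h, i, j, k, m, rfl⟩ := exists_eq_cubic hU
  rw [linSubst_swap02_cubic, b₂_cubic, b₂_cubic]
  ring

theorem b₂_swap12 {U : MvPolynomial (Fin 3) F} (hU : U.IsHomogeneous 3) :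
    b₂ (linSubst !![1, 0, 0; 0, 0, 1; 0, 1, 0] U) = b₂ U := by
  obtain ⟨a, b, c, f, g, h, i, j, k, m, rfl⟩ := exists_eq_cubic hU
  rw [linSubst_swap12_cubic, b₂_cubic, b₂_cubic]
  ring

end BTwo

/-! ### Values at (0:0:1) when the tangent there is x = 0 -/

section FlexValue

variable {F : Type*} [Field F]

theorem hessMatrix_cubic (a b c f g h i j k m : F) :
    hessMatrix (cubic a b c f g h i j k m) =
      !![C (6 * a) * X 0 + C (2 * h) * X 1 + C (2 * j) * X 2,
          C (2 * h) * X 0 + C (2 * k) * X 1 + C m * X 2,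
          C (2 * j) * X 0 + C m * X 1 + C (2 * g) * X 2;
        C (2 * h) * X 0 + C (2 * k) * X 1 + C m * X 2,
          C (2 * k) * X 0 + C (6 * b) * X 1 + C (2 * f) * X 2,
          C m * X 0 + C (2 * f) * X 1 + C (2 * i) * X 2;
        C (2 * j) * X 0 + C m * X 1 + C (2 * g) * X 2,
          C m * X 0 + C (2 * f) * X 1 + C (2 * i) * X 2,
          C (2 * g) * X 0 + C (2 * i) * X 1 + C (6 * c) * X 2] := by
  have hn (n : ℕ) [n.AtLeastTwo] : (C (OfNat.ofNat n : F) : MvPolynomial (Fin 3) F) =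
    OfNat.ofNat n := map_ofNat C n
  have hd (i : Fin 3) (n : ℕ) [n.AtLeastTwo] :
      pderiv i (OfNat.ofNat n : MvPolynomial (Fin 3) F) = 0 := by rw [← hn, pderiv_C]
  ext1 r s
  fin_cases r <;> fin_cases s <;>
  · simp [hessMatrix, cubic, pderiv_X, Derivation.leibniz, Derivation.leibniz_pow, hn, hd,
      Pi.single_apply]
    try ring

variable [CharZero F]

theorem eval_hessian_cubic (f g b h j k m a : F) :
    eval ![0, 0, 1] (hessian (cubic a b 0 f g h 0 j k m)) = 4 * (f * g ^ 2) := by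
  rw [hessian, hessMatrix_cubic, Matrix.det_fin_three]
  simp
  ring

theorem eval_covZ_cubic (a b f g h j k m : F) :
    eval ![0, 0, 1] (covZ (cubic a b 0 f g h 0 j k m)) = f * g ^ 2 := by
  rw [covZ]
  simp only [map_mul, map_add, eval_C, eval_hessian_cubic]
  simp [cubic]

/-- The vanishing coefficients of z³ and y z² put (0:0:1) on the curve and, for g ≠ 0, make x = 0
its tangent. With b₂Z² removed, what is left of Θ involves only b, f, g, k, m. -/
theorem eval_covX_cubic (a b f g h j k m : F) :
    eval ![0, 0, 1] (covX (cubic a b 0 f g h 0 j k m)) =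
      g ^ 5 * (b ^ 2 * g - b * f * m + f ^ 2 * k) := by
  have hU : eval ![0, 0, 1] (cubic a b 0 f g h 0 j k m) = 0 := by simp [cubic]
  have hH (r : Fin 3) : eval ![0, 0, 1] (pderiv r (hessian (cubic a b 0 f g h 0 j k m))) =
      ![4 * f * g * j + 4 * g ^ 2 * k - g * m ^ 2, 12 * b * g ^ 2, 12 * f * g ^ 2] r := by
    rw [hessian, hessMatrix_cubic, Matrix.det_fin_three]
    fin_cases r <;>
    · simp [pderiv_X, Derivation.leibniz]
      ring
  have hT : eval ![0, 0, 1] (theta (cubic a b 0 f g h 0 j k m)) =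
      192 * (g ^ 5 * (b ^ 2 * g - b * f * m + f ^ 2 * k)) +
        16 * (m ^ 2 - 4 * (f * j + g * k)) * (f * g ^ 2) ^ 2 := by
    -- Indexing the bordered matrix by `Fin 4` lets the determinant be expanded entry by entry.
    rw [theta, map_mul, eval_C, RingHom.map_det, ← Matrix.det_reindex_self finSumFinEquiv]
    have hM : Matrix.reindex finSumFinEquiv finSumFinEquiv ((eval ![0, 0, 1]).mapMatrix
        (Matrix.fromBlocks (hessMatrix (cubic a b 0 f g h 0 j k m))
          (Matrix.of fun r (_ : Fin 1) => pderiv r (hessian (cubic a b 0 f g h 0 j k m)))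
          (Matrix.of fun (_ : Fin 1) s => pderiv s (hessian (cubic a b 0 f g h 0 j k m))) 0)) =
        !![2 * j, m, 2 * g, 4 * f * g * j + 4 * g ^ 2 * k - g * m ^ 2;
          m, 2 * f, 0, 12 * b * g ^ 2; 2 * g, 0, 0, 12 * f * g ^ 2;
          4 * f * g * j + 4 * g ^ 2 * k - g * m ^ 2, 12 * b * g ^ 2, 12 * f * g ^ 2, 0] := by
      have e0 : (0 : Fin 4) = Fin.castAdd 1 0 := rfl
      have e1 : (1 : Fin 4) = Fin.castAdd 1 1 := rfl
      have e2 : (2 : Fin 4) = Fin.castAdd 1 2 := rfl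
      have e3 : (3 : Fin 4) = Fin.natAdd 3 (0 : Fin 1) := rfl
      ext1 r s
      rw [Matrix.reindex_apply, Matrix.submatrix_apply]
      have hsymm (r : Fin 4) : finSumFinEquiv.symm r =
          (![Sum.inl 0, Sum.inl 1, Sum.inl 2, Sum.inr 0] : Fin 4 → Fin 3 ⊕ Fin 1) r := by
        fin_cases r <;> rfl
      rw [hsymm, hsymm]
      fin_cases r <;> fin_cases s <;> simp [hH, hessMatrix_cubic]
    erw [hM]
    simp [Matrix.det_succ_row_zero, Fin.sum_univ_succ, Fin.succAbove]
    ring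
  rw [covX]
  simp only [map_mul, map_add, map_sub, map_pow, eval_C, eval_covZ_cubic, hT, hU, b₂_cubic]
  field_simp
  ring

end FlexValue

/-! ### The absolute value and the invariance of max(|Z²|, |X|) -/

section AbsVal

variable {O : Type*} [CommRing O] [IsDomain O] [IsDiscreteValuationRing O]
  {K : Type*} [Field K] [Algebra O K] [IsFractionRing O K] {c : ℝ}

theorem absVal_zero : absVal O c (0 : K) = 0 := by
  simp [absVal]

theorem absVal_of_ne_zero {x : K} (hx : x ≠ 0) : absVal O c x =
    c ^ (WithZero.log ((IsDiscreteValuationRing.maximalIdeal O).valuation K x) : ℤ) := by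
  simp [absVal, hx]

theorem absVal_pos (hc : 1 < c) {x : K} (hx : x ≠ 0) : 0 < absVal O c x := by
  rw [absVal_of_ne_zero hx]
  exact zpow_pos (by linarith) _

theorem absVal_nonneg (hc : 1 < c) (x : K) : 0 ≤ absVal O c x := by
  by_cases hx : x = 0
  · simp [hx, absVal_zero]
  · exact (absVal_pos hc hx).le

theorem absVal_mul (hc : 1 < c) (x y : K) : absVal O c (x * y) = absVal O c x * absVal O c y := by
  by_cases hx : x = 0
  · simp [hx, absVal_zero]
  by_cases hy : y = 0
  · simp [hy, absVal_zero]
  rw [absVal_of_ne_zero hx, absVal_of_ne_zero hy, absVal_of_ne_zero (mul_ne_zero hx hy), map_mul,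
    WithZero.log_mul, zpow_add₀ (by linarith)]
  · simpa using hx
  · simpa using hy

theorem absVal_le_absVal (hc : 1 < c) {x y : K}
    (h : (IsDiscreteValuationRing.maximalIdeal O).valuation K x ≤
      (IsDiscreteValuationRing.maximalIdeal O).valuation K y) : absVal O c x ≤ absVal O c y := by
  by_cases hx : x = 0
  · simpa [hx, absVal_zero] using absVal_nonneg hc y
  have hvx : (IsDiscreteValuationRing.maximalIdeal O).valuation K x ≠ 0 := by simpa using hx
  have hvy : (IsDiscreteValuationRing.maximalIdeal O).valuation K y ≠ 0 := fun h0 =>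
    hvx (le_zero_iff.1 (h0 ▸ h))
  have hy : y ≠ 0 := by simpa using hvy
  rw [absVal_of_ne_zero hx, absVal_of_ne_zero hy]
  exact zpow_le_zpow_right₀ hc.le ((WithZero.log_le_log hvx hvy).2 h)

theorem absVal_one : absVal O c (1 : K) = 1 := by
  simp [absVal]

/-- The absolute value as a monoid homomorphism with zero. -/
noncomputable def absValHom (O : Type*) [CommRing O] [IsDomain O] [IsDiscreteValuationRing O]
    (K : Type*) [Field K] [Algebra O K] [IsFractionRing O K] (hc : 1 < c) : K →*₀ ℝ where
  toFun := absVal O c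
  map_zero' := absVal_zero
  map_one' := absVal_one
  map_mul' := absVal_mul hc

theorem absVal_pow (hc : 1 < c) (x : K) (n : ℕ) : absVal O c (x ^ n) = absVal O c x ^ n :=
  map_pow (absValHom O K hc) x n

theorem absVal_sub_le (hc : 1 < c) (x y : K) :
    absVal O c (x - y) ≤ max (absVal O c x) (absVal O c y) := by
  rcases le_max_iff.1
    (((IsDiscreteValuationRing.maximalIdeal O).valuation K).map_sub x y) with h | h
  · exact le_max_of_le_left (absVal_le_absVal hc h)
  · exact le_max_of_le_right (absVal_le_absVal hc h)

theorem absVal_algebraMap_le_one (hc : 1 < c) (x : O) : absVal O c (algebraMap O K x) ≤ 1 := by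
  rw [← absVal_one (O := O) (K := K) (c := c)]
  apply absVal_le_absVal hc
  rw [map_one]
  exact IsDedekindDomain.HeightOneSpectrum.valuation_le_one _ x

theorem absVal_algebraMap_of_isUnit (hc : 1 < c) {x : O} (hx : IsUnit x) :
    absVal O c (algebraMap O K x) = 1 := by
  obtain ⟨y, hxy⟩ := hx.exists_right_inv
  have h := absVal_mul (O := O) hc (algebraMap O K x) (algebraMap O K y)
  rw [← map_mul, hxy, map_one, absVal_one] at h
  have h1 := absVal_algebraMap_le_one (K := K) hc x
  have h2 := absVal_algebraMap_le_one (K := K) hc y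
  have h3 := absVal_nonneg (O := O) hc (algebraMap O K x)
  nlinarith

/-- By the ultrametric inequality an integral multiple of B is absorbed, in both directions (use r,
then -r). With B = Z² this disposes of the correction term in X. -/
theorem max_absVal_sub_mul (hc : 1 < c) (A B : K) (r : O) :
    max (absVal O c B) (absVal O c (A - algebraMap O K r * B)) =
      max (absVal O c B) (absVal O c A) := by
  have hr : absVal O c (algebraMap O K r * B) ≤ absVal O c B := by
    rw [absVal_mul hc]
    exact mul_le_of_le_one_left (absVal_nonneg hc _) (absVal_algebraMap_le_one hc r)
  have hr' : absVal O c (algebraMap O K (-r) * B) ≤ absVal O c B := by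
    rw [absVal_mul hc]
    exact mul_le_of_le_one_left (absVal_nonneg hc _) (absVal_algebraMap_le_one hc _)
  apply le_antisymm
  · refine max_le (le_max_left _ _) ((absVal_sub_le hc _ _).trans (max_le (le_max_right _ _) ?_))
    exact hr.trans (le_max_left _ _)
  · refine max_le (le_max_left _ _) ?_
    have h := absVal_sub_le (O := O) hc (A - algebraMap O K r * B) (algebraMap O K (-r) * B)
    have e : A - algebraMap O K r * B - algebraMap O K (-r) * B = A := by
      rw [map_neg]; ring
    rw [e] at h
    exact h.trans (max_le (le_max_right _ _) (hr'.trans (le_max_left _ _)))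

/-- `max (|F₃(v)|, |G₃(v)|)`. -/
noncomputable def covMax (O : Type*) [CommRing O] [IsDomain O] [IsDiscreteValuationRing O]
    {K : Type*} [Field K] [Algebra O K] [IsFractionRing O K] (c : ℝ)
    (U : MvPolynomial (Fin 3) K) (v : Fin 3 → K) : ℝ :=
  max (absVal O c (eval v (covZ U) ^ 2)) (absVal O c (eval v (covX U)))

variable [CharZero K]

/-- The weights of Z² and X are t²(t det g)⁴ and t²(t det g)⁶; as |t det g| = 1, both have absolute
value |t|². -/
theorem covMax_linSubst (hc : 1 < c) (t : K) (g : Matrix (Fin 3) (Fin 3) K)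
    (htg : absVal O c (t * g.det) = 1) (U : MvPolynomial (Fin 3) K) (v : Fin 3 → K)
    (hv : eval (g.mulVec v) U = 0)
    (hr : ∃ r, b₂ (C t * linSubst g U) = (t * g.det) ^ 2 * b₂ U + 12 * algebraMap O K r) :
    covMax O c (C t * linSubst g U) v = absVal O c t ^ 2 * covMax O c U (g.mulVec v) := by
  obtain ⟨r, hr⟩ := hr
  rw [covMax, eval_covX_linSubst t g U v hv _ hr, max_absVal_sub_mul hc,
    eval_covZ_linSubst t g U v hv, covMax, mul_max_of_nonneg _ _ (sq_nonneg _)]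
  congr 1
  · rw [show (t ^ 3 * g.det ^ 2 * eval (g.mulVec v) (covZ U)) ^ 2 =
      t ^ 2 * (t * g.det) ^ 4 * eval (g.mulVec v) (covZ U) ^ 2 by ring, absVal_mul hc,
      absVal_mul hc, absVal_pow hc, absVal_pow hc (t * _), htg]
    ring
  · rw [show t ^ 8 * g.det ^ 6 * eval (g.mulVec v) (covX U) =
      t ^ 2 * (t * g.det) ^ 6 * eval (g.mulVec v) (covX U) by ring, absVal_mul hc,
      absVal_mul hc, absVal_pow hc, absVal_pow hc (t * _), htg]
    ring

/-- The scalar matrix d combined with t = d⁻³ fixes U, so homogeneity of degree 6 is itself an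
instance of the transformation rule. -/
theorem covMax_smul (hc : 1 < c) {U : MvPolynomial (Fin 3) K} (hU : U.IsHomogeneous 3)
    {v : Fin 3 → K} (hv : eval v U = 0) {d : K} (hd : d ≠ 0) :
    covMax O c U (d • v) = absVal O c d ^ 6 * covMax O c U v := by
  have hdet : (!![d, 0, 0; 0, d, 0; 0, 0, d] : Matrix (Fin 3) (Fin 3) K).det = d ^ 3 := by
    simp [Matrix.det_fin_three]; ring
  have hmul : (!![d, 0, 0; 0, d, 0; 0, 0, d] : Matrix (Fin 3) (Fin 3) K).mulVec v = d • v := by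
    ext i
    fin_cases i <;> simp [Matrix.mulVec, dotProduct, Fin.sum_univ_three]
  have hlin : C ((d ^ 3)⁻¹) * linSubst !![d, 0, 0; 0, d, 0; 0, 0, d] U = U := by
    obtain ⟨a, b, c, f, g, h, i, j, k, m, rfl⟩ := exists_eq_cubic hU
    rw [linSubst_scalar_cubic, ← mul_assoc, ← C_mul, inv_mul_cancel₀ (pow_ne_zero 3 hd), C_1,
      one_mul]
  have hdv : eval (d • v) U = 0 := by
    rw [← hmul, ← eval_linSubst]
    obtain ⟨a, b, c, f, g, h, i, j, k, m, rfl⟩ := exists_eq_cubic hU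
    rw [linSubst_scalar_cubic, map_mul, hv, mul_zero]
  have h := covMax_linSubst (O := O) hc ((d ^ 3)⁻¹) !![d, 0, 0; 0, d, 0; 0, 0, d]
    (by rw [hdet, inv_mul_cancel₀ (pow_ne_zero 3 hd), absVal_one]) U v (by rw [hmul, hdv])
    ⟨0, by rw [hlin, hdet, inv_mul_cancel₀ (pow_ne_zero 3 hd)]; simp⟩
  rw [hlin, hmul] at h
  have h1 : absVal O c ((d ^ 3)⁻¹) * absVal O c d ^ 3 = 1 := by
    rw [← absVal_pow hc, ← absVal_mul hc, inv_mul_cancel₀ (pow_ne_zero 3 hd), absVal_one]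
  rw [h, ← mul_assoc, show absVal O c d ^ 6 * absVal O c ((d ^ 3)⁻¹) ^ 2 =
    (absVal O c ((d ^ 3)⁻¹) * absVal O c d ^ 3) ^ 2 by ring, h1, one_pow, one_mul]

theorem covMax_unimodular (hc : 1 < c) (g : Matrix (Fin 3) (Fin 3) O) (hg : IsUnit g.det)
    (U : MvPolynomial (Fin 3) O) (v : Fin 3 → O) (hv : eval (g.mulVec v) U = 0)
    (hr : ∃ r, b₂ (map (algebraMap O K) (linSubst g U)) =
      algebraMap O K g.det ^ 2 * b₂ (map (algebraMap O K) U) + 12 * algebraMap O K r) :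
    covMax O c (map (algebraMap O K) (linSubst g U)) (algebraMap O K ∘ v) =
      covMax O c (map (algebraMap O K) U) (algebraMap O K ∘ g.mulVec v) := by
  have hdet : (g.map (algebraMap O K)).det = algebraMap O K g.det :=
    ((algebraMap O K).map_det g).symm
  have hmv : (g.map (algebraMap O K)).mulVec (algebraMap O K ∘ v) =
      algebraMap O K ∘ g.mulVec v := by
    ext i
    simp [Matrix.mulVec, dotProduct]
  have h := covMax_linSubst (O := O) (c := c) hc 1 (g.map (algebraMap O K))
    (by rw [hdet, one_mul, absVal_algebraMap_of_isUnit hc hg])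
    (map (algebraMap O K) U) (algebraMap O K ∘ v)
    (by rw [hmv, ← map_eval, hv, map_zero])
    (by rw [C_1, one_mul, one_mul, ← map_linSubst, hdet]; exact hr)
  rwa [C_1, one_mul, absVal_one, one_pow, one_mul, ← map_linSubst, hmv] at h

end AbsVal

/-! ### Congruences and simple roots -/

theorem aeval_sub_aeval_dvd {R σ A : Type*} [CommRing R] [CommRing A] [Algebra R A] {d : A}
    {f g : σ → A} (h : ∀ i, d ∣ f i - g i) (U : MvPolynomial σ R) :
    d ∣ aeval f U - aeval g U := by
  rw [← Ideal.mem_span_singleton, ← Ideal.Quotient.eq]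
  have : (Ideal.Quotient.mkₐ R (Ideal.span {d})).comp (aeval f) =
      (Ideal.Quotient.mkₐ R (Ideal.span {d})).comp (aeval g) := by
    apply MvPolynomial.algHom_ext
    intro i
    simpa using Ideal.Quotient.eq.2 (Ideal.mem_span_singleton.2 (h i))
  exact congrArg (fun φ => φ U) this

/-- A simple root modulo `π` has at most one lift modulo `π ^ n`. -/
theorem pow_dvd_sub_of_derivative_not_dvd {A : Type*} [CommRing A] [IsDomain A] {π : A}
    (hπ : Prime π) (P : Polynomial A) {x y : A} {n : ℕ} (hxy : π ∣ y - x)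
    (hd : ¬ π ∣ P.derivative.eval x) (h : π ^ n ∣ P.eval y - P.eval x) : π ^ n ∣ y - x := by
  -- P(y) - P(x) = (P'(x) + k (y - x)) (y - x), and the first factor is prime to π, so every power
  -- of π divides the second.
  obtain ⟨k, hk⟩ := P.binomExpansion x (y - x)
  have e : P.eval y - P.eval x = (P.derivative.eval x + k * (y - x)) * (y - x) := by
    rw [add_sub_cancel] at hk
    rw [hk]; ring
  rw [e] at h
  refine hπ.pow_dvd_of_dvd_mul_left n (fun h' => hd ?_) h
  exact (dvd_add_left (hxy.mul_left k)).1 h'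

/-! ### Restriction to lines x + a y + b z = 0 -/

section Lines

variable {R : Type*} [CommRing R]

/-- The restriction of `U` to the line `x + a y + b z = 0`. -/
noncomputable def onLine (a b : R) (U : MvPolynomial (Fin 3) R) : MvPolynomial (Fin 2) R :=
  aeval ![-(C a * X 0 + C b * X 1), X 0, X 1] U

/-- The matrix of the substitution `x ← d x - a y - b z`. -/
def shearMatrix (d a b : R) : Matrix (Fin 3) (Fin 3) R := !![d, -a, -b; 0, 1, 0; 0, 0, 1]

theorem det_shearMatrix (d a b : R) : (shearMatrix d a b).det = d := by
  simp [shearMatrix, Matrix.det_fin_three]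

theorem shearMatrix_mul (d a b d' a' b' : R) :
    shearMatrix d a b * shearMatrix d' a' b' = shearMatrix (d * d') (a + d * a') (b + d * b') := by
  ext i j
  fin_cases i <;> fin_cases j <;>
    simp [shearMatrix, Matrix.mul_apply, Fin.sum_univ_three, add_comm]

theorem mulVec_shearMatrix (d a b x y z : R) :
    (shearMatrix d a b).mulVec ![x, y, z] = ![d * x - a * y - b * z, y, z] := by
  ext i
  fin_cases i <;> simp [shearMatrix, Matrix.mulVec, dotProduct, Fin.sum_univ_three]
  ring

/-- With d = π^n, lines for the transformed cubic correspond to lines for U congruent to (a, b)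
modulo π^n. -/
theorem onLine_linSubst (d a b a' b' : R) (U : MvPolynomial (Fin 3) R) :
    onLine a' b' (linSubst (shearMatrix d a b) U) = onLine (a + d * a') (b + d * b') U := by
  have : (aeval ![-(C a' * X 0 + C b' * X 1), X 0, X 1] :
      MvPolynomial (Fin 3) R →ₐ[R] MvPolynomial (Fin 2) R).comp (linSubst (shearMatrix d a b)) =
      aeval ![-(C (a + d * a') * X 0 + C (b + d * b') * X 1), X 0, X 1] := by
    apply MvPolynomial.algHom_ext
    intro i
    fin_cases i <;> simp [linSubst, shearMatrix, Fin.sum_univ_three]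
    ring
  exact congrArg (fun φ => φ U) this

theorem onLine_C_mul (a b d : R) (U : MvPolynomial (Fin 3) R) :
    onLine a b (C d * U) = C d * onLine a b U := by
  simp [onLine]

theorem eval_onLine (a b y z : R) (U : MvPolynomial (Fin 3) R) :
    eval ![y, z] (onLine a b U) = eval ![-(a * y + b * z), y, z] U := by
  have : ((eval ![y, z]).comp (aeval ![-(C a * X 0 + C b * X 1), X 0, X 1] :
      MvPolynomial (Fin 3) R →ₐ[R] MvPolynomial (Fin 2) R).toRingHom) =
      eval ![-(a * y + b * z), y, z] := by
    apply MvPolynomial.ringHom_ext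
    · intro r; simp
    · intro i; fin_cases i <;> simp
  exact congrArg (fun φ => φ U) this

theorem onLine_eq_eval (a b : R) (U : MvPolynomial (Fin 3) R) :
    onLine a b U = (finSuccEquiv R 2 U).eval (-(C a * X 0 + C b * X 1)) := by
  have : (aeval ![-(C a * X 0 + C b * X 1), X 0, X 1] :
      MvPolynomial (Fin 3) R →ₐ[R] MvPolynomial (Fin 2) R).toRingHom =
      (Polynomial.evalRingHom (-(C a * X 0 + C b * X 1))).comp
        (finSuccEquiv R 2 : _ →ₐ[R] _).toRingHom := by
    apply MvPolynomial.ringHom_ext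
    · intro r; simp [finSuccEquiv_apply]
    · intro i
      have h1 : finSuccEquiv R 2 (X 1) = Polynomial.C (X 0) := finSuccEquiv_X_succ (j := 0)
      have h2 : finSuccEquiv R 2 (X 2) = Polynomial.C (X 1) := finSuccEquiv_X_succ (j := 1)
      fin_cases i <;> simp [finSuccEquiv_X_zero, h1, h2]
  exact congrArg (fun φ => φ U) this

theorem finSuccEquiv_linSubst_shearMatrix (d a b : R) (U : MvPolynomial (Fin 3) R) :
    finSuccEquiv R 2 (linSubst (shearMatrix d a b) U) =
      (finSuccEquiv R 2 U).comp
        (Polynomial.C (C d) * Polynomial.X - Polynomial.C (C a * X 0 + C b * X 1)) := by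
  have : (finSuccEquiv R 2 :
        MvPolynomial (Fin 3) R →ₐ[R] Polynomial (MvPolynomial (Fin 2) R)).toRingHom.comp
        (linSubst (shearMatrix d a b) : _ →ₐ[R] _).toRingHom =
      (Polynomial.compRingHom
        (Polynomial.C (C d) * Polynomial.X - Polynomial.C (C a * X 0 + C b * X 1))).comp
        (finSuccEquiv R 2 :
          MvPolynomial (Fin 3) R →ₐ[R] Polynomial (MvPolynomial (Fin 2) R)).toRingHom := by
    have hC (r : R) : finSuccEquiv R 2 (C r) = Polynomial.C (C r) := by simp [finSuccEquiv_apply]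
    have h1 : finSuccEquiv R 2 (X 1) = Polynomial.C (X 0) := finSuccEquiv_X_succ (j := 0)
    have h2 : finSuccEquiv R 2 (X 2) = Polynomial.C (X 1) := finSuccEquiv_X_succ (j := 1)
    apply MvPolynomial.ringHom_ext
    · intro r; simp [linSubst, hC]
    · intro i
      fin_cases i <;> simp [linSubst, shearMatrix, Fin.sum_univ_three, finSuccEquiv_X_zero, h1, h2,
        hC]
      ring
  exact congrArg (fun φ => φ U) this

/-- If `d` divides the restriction of `U` to a line, then it divides `U (d x - a y - b z, y, z)`. -/
theorem C_dvd_linSubst_shearMatrix {d a b : R} {U : MvPolynomial (Fin 3) R}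
    (h : C d ∣ onLine a b U) : C d ∣ linSubst (shearMatrix d a b) U := by
  -- Modulo d the term d x disappears, leaving the restriction to the line regarded as a polynomial
  -- free of x.
  have h1 : C d ∣ linSubst (shearMatrix d a b) U -
      aeval ![-(C a * X 1 + C b * X 2), X 1, X 2] U := by
    apply aeval_sub_aeval_dvd
    intro i
    fin_cases i
    · exact ⟨X 0, by simp [shearMatrix, Fin.sum_univ_three]; ring⟩
    · simp [shearMatrix, Fin.sum_univ_three]
    · simp [shearMatrix, Fin.sum_univ_three]
  have h2 : aeval ![-(C a * X 1 + C b * X 2), X 1, X 2] U =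
      rename (Fin.succ : Fin 2 → Fin 3) (onLine a b U) := by
    have : (aeval ![-(C a * X 1 + C b * X 2), X 1, X 2] :
        MvPolynomial (Fin 3) R →ₐ[R] MvPolynomial (Fin 3) R) =
        (rename (Fin.succ : Fin 2 → Fin 3)).comp
          (aeval ![-(C a * X 0 + C b * X 1), X 0, X 1]) := by
      apply MvPolynomial.algHom_ext
      intro i
      fin_cases i <;> simp
    exact congrArg (fun φ => φ U) this
  obtain ⟨V, hV⟩ := h
  rw [h2, hV, map_mul, rename_C] at h1
  exact (dvd_sub_left (Dvd.intro _ rfl)).1 h1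

theorem dvd_of_C_dvd_linear {d a b : R}
    (h : C d ∣ (C a * X 0 + C b * X 1 : MvPolynomial (Fin 2) R)) :
    d ∣ a ∧ d ∣ b := by
  obtain ⟨q, hq⟩ := h
  constructor
  · have := congrArg (coeff (Finsupp.single 0 1)) hq
    rw [coeff_C_mul, coeff_add, coeff_C_mul, coeff_C_mul, coeff_X, coeff_X] at this
    exact ⟨_, by simpa [Finsupp.single_left_inj] using this⟩
  · have := congrArg (coeff (Finsupp.single 1 1)) hq
    rw [coeff_C_mul, coeff_add, coeff_C_mul, coeff_C_mul, coeff_X, coeff_X] at this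
    exact ⟨_, by simpa [Finsupp.single_left_inj] using this⟩

end Lines

/-! ### Lines modulo powers of π -/

section Reduction

variable {O : Type*} [CommRing O] {π : O}

theorem scaleX_eq_linSubst (U : MvPolynomial (Fin 3) O) :
    scaleX π U = linSubst (shearMatrix π 0 0) U := by
  rw [scaleX, linSubst]
  congr 2
  ext1 i
  fin_cases i <;> simp [shearMatrix, Fin.sum_univ_three]

theorem shear_eq_linSubst (a b : O) (U : MvPolynomial (Fin 3) O) :
    shear a b U = linSubst (shearMatrix 1 a b) U := by
  rw [shear, linSubst]
  congr 2
  ext1 i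
  fin_cases i <;> simp [shearMatrix, Fin.sum_univ_three]
  ring

theorem f₃_eq_onLine (U : MvPolynomial (Fin 3) O) : f₃ U = onLine 0 0 U := by
  rw [f₃, xCoeff, onLine_eq_eval, Polynomial.coeff_zero_eq_eval_zero]
  simp

variable {U W : MvPolynomial (Fin 3) O} {n : ℕ} {a b : O}

/-- f₂ is the x-derivative of U at x = 0. Thus f₂ ≢ 0 (mod π) says that the line is a simple root of
U over O[y, z]. -/
theorem C_dvd_derivative_eval_sub_f₂ (ha : π ∣ a) (hb : π ∣ b) (U : MvPolynomial (Fin 3) O) :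
    C π ∣ (finSuccEquiv O 2 U).derivative.eval (-(C a * X 0 + C b * X 1)) - f₂ U := by
  have h : f₂ U = (finSuccEquiv O 2 U).derivative.eval 0 := by
    rw [← Polynomial.coeff_zero_eq_eval_zero, Polynomial.coeff_derivative, f₂, xCoeff]
    simp
  rw [h]
  refine dvd_trans ?_ (Polynomial.sub_dvd_eval_sub _ _ _)
  rw [sub_zero, dvd_neg]
  exact dvd_add ((map_dvd C ha).mul_right _) ((map_dvd C hb).mul_right _)

/-- Modulo π the cubic W is linear in x, namely f₂ x + f₃; substitute x = -(a y + b z). -/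
theorem C_dvd_onLine_sub (h : ∀ i, 2 ≤ i → C π ∣ xCoeff W i) (a b : O) :
    C π ∣ onLine a b W - (f₃ W - (C a * X 0 + C b * X 1) * f₂ W) := by
  rw [onLine_eq_eval, f₃, f₂, xCoeff, xCoeff]
  set Q := finSuccEquiv O 2 W with hQ
  have hR : Polynomial.C (C π) ∣ Q.divX.divX := by
    rw [Polynomial.C_dvd_iff_dvd_coeff]
    intro i
    rw [Polynomial.coeff_divX, Polynomial.coeff_divX]
    exact h _ (by omega)
  obtain ⟨S, hS⟩ := hR
  have e1 := Polynomial.divX_mul_X_add Q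
  have e2 := Polynomial.divX_mul_X_add Q.divX
  rw [Polynomial.coeff_divX] at e2
  rw [← e2, hS] at e1
  refine ⟨S.eval (-(C a * X 0 + C b * X 1)) * (C a * X 0 + C b * X 1) ^ 2, ?_⟩
  nth_rewrite 1 [← e1]
  simp only [Polynomial.eval_add, Polynomial.eval_mul, Polynomial.eval_C, Polynomial.eval_X]
  ring

/-- `U` vanishes modulo `π ^ n` on a line `x + a y + b z = 0` reducing to `x = 0`. -/
def HasLineMod (π : O) (U : MvPolynomial (Fin 3) O) (n : ℕ) : Prop :=
  ∃ a b, π ∣ a ∧ π ∣ b ∧ C (π ^ n) ∣ onLine a b U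

theorem HasLineMod.mono {m : ℕ} (h : HasLineMod π U n) (hmn : m ≤ n) : HasLineMod π U m := by
  obtain ⟨a, b, ha, hb, h⟩ := h
  exact ⟨a, b, ha, hb, (map_dvd C (pow_dvd_pow π hmn)).trans h⟩

theorem onLine_of_C_mul_eq {d : O} (hW : C d * W = linSubst (shearMatrix d a b) U) (a' b' : O) :
    C d * onLine a' b' W = onLine (a + d * a') (b + d * b') U := by
  rw [← onLine_C_mul, hW, onLine_linSubst]

variable [IsDomain O]

/-- Scaling x multiplies the coefficient of x^(i+1) by π^(n(i+1)), and the division removes one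
factor π^n. Hence f₁ and f₀ become divisible by π as soon as n ≥ 1. -/
theorem xCoeff_of_C_mul_eq (hπ : Irreducible π)
    (hW : C (π ^ n) * W = linSubst (shearMatrix (π ^ n) a b) U) (i : ℕ) :
    xCoeff W (i + 1) = C (π ^ n) ^ i * ((finSuccEquiv O 2 U).comp
      (Polynomial.X - Polynomial.C (C a * X 0 + C b * X 1))).coeff (i + 1) := by
  have h := congrArg (fun V => (finSuccEquiv O 2 V).coeff (i + 1)) hW
  have hC : finSuccEquiv O 2 (C (π ^ n)) = Polynomial.C (C (π ^ n)) := by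
    simp [finSuccEquiv_apply]
  have hcomp : (finSuccEquiv O 2 U).comp
      (Polynomial.C (C (π ^ n)) * Polynomial.X - Polynomial.C (C a * X 0 + C b * X 1)) =
      ((finSuccEquiv O 2 U).comp (Polynomial.X - Polynomial.C (C a * X 0 + C b * X 1))).comp
        (Polynomial.C (C (π ^ n)) * Polynomial.X) := by
    rw [Polynomial.comp_assoc, Polynomial.sub_comp, Polynomial.X_comp, Polynomial.C_comp]
  simp only [map_mul, hC, Polynomial.coeff_C_mul, finSuccEquiv_linSubst_shearMatrix] at h
  rw [hcomp, Polynomial.comp_C_mul_X_coeff, pow_succ] at h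
  have h0 : (C (π ^ n) : MvPolynomial (Fin 2) O) ≠ 0 :=
    (map_ne_zero_iff C (C_injective _ _)).2 (pow_ne_zero n hπ.ne_zero)
  apply mul_left_cancel₀ h0
  rw [xCoeff, h]
  ring

theorem C_dvd_xCoeff_of_C_mul_eq (hπ : Irreducible π)
    (hW : C (π ^ n) * W = linSubst (shearMatrix (π ^ n) a b) U) (hn : 1 ≤ n) {i : ℕ} (hi : 2 ≤ i) :
    C π ∣ xCoeff W i := by
  obtain ⟨j, rfl⟩ := Nat.exists_eq_add_of_le' hi
  rw [xCoeff_of_C_mul_eq hπ hW (j + 1), map_pow, ← pow_mul]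
  exact (dvd_pow_self _ (by positivity)).mul_right _

variable [IsDiscreteValuationRing O]

theorem residue_eq_zero_iff_dvd (hπ : Irreducible π) (x : O) :
    IsLocalRing.residue O x = 0 ↔ π ∣ x := by
  rw [IsLocalRing.residue_eq_zero_iff, hπ.maximalIdeal_eq, Ideal.mem_span_singleton]

theorem C_dvd_iff_red_eq_zero (hπ : Irreducible π) {σ : Type*} (U : MvPolynomial σ O) :
    C π ∣ U ↔ red U = 0 :=
  C_dvd_iff_map_hom_eq_zero _ _ (residue_eq_zero_iff_dvd hπ) _

theorem prime_C_uniformizer (hπ : Irreducible π) {σ : Type*} : Prime (C π : MvPolynomial σ O) :=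
  (prime_C_iff _).2 hπ.prime

/-- This is the geometric meaning of step (iii): an admissible choice of a, b is a line x + a y + b
z = 0 on the reduction of W. -/
theorem C_dvd_onLine_iff (hπ : Irreducible π) (h : ∀ i, 2 ≤ i → C π ∣ xCoeff W i) (a b : O) :
    C π ∣ onLine a b W ↔ red (f₃ W) = red ((C a * X 0 + C b * X 1) * f₂ W) := by
  rw [← sub_eq_zero, red, red, ← map_sub, ← red, ← C_dvd_iff_red_eq_zero hπ]
  exact dvd_iff_dvd_of_dvd_sub (C_dvd_onLine_sub h a b)

/-- The current line and a line good modulo π^(n+1) are both roots of U modulo π^n over O[y, z], and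
congruent modulo π. The root is simple, so they agree modulo π^n; their difference divided by π^n is
the required line for W. -/
theorem exists_C_dvd_onLine (hπ : Irreducible π) (hU : ¬ C π ∣ f₂ U) (ha : π ∣ a) (hb : π ∣ b)
    (hW : C (π ^ n) * W = linSubst (shearMatrix (π ^ n) a b) U) (h : HasLineMod π U (n + 1)) :
    ∃ a' b', C π ∣ onLine a' b' W := by
  obtain ⟨a₁, b₁, ha₁, hb₁, h₁⟩ := h
  have hlin (a b : O) (ha : π ∣ a) (hb : π ∣ b) :
      C π ∣ (C a * X 0 + C b * X 1 : MvPolynomial (Fin 2) O) :=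
    dvd_add ((map_dvd C ha).mul_right _) ((map_dvd C hb).mul_right _)
  have key := pow_dvd_sub_of_derivative_not_dvd (prime_C_uniformizer hπ) (finSuccEquiv O 2 U)
    (x := -(C a * X 0 + C b * X 1)) (y := -(C a₁ * X 0 + C b₁ * X 1)) (n := n)
    (dvd_sub (hlin a₁ b₁ ha₁ hb₁).neg_right (hlin a b ha hb).neg_right)
    (fun h' => hU ((dvd_iff_dvd_of_dvd_sub (C_dvd_derivative_eval_sub_f₂ ha hb U)).1 h'))
    (by
      rw [← onLine_eq_eval, ← onLine_eq_eval, ← map_pow]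
      refine dvd_sub ((map_dvd C (pow_dvd_pow π (Nat.le_succ n))).trans h₁) ?_
      -- The line x = 0 for W is the current line for U, on which U is therefore divisible by π^n.
      have := onLine_of_C_mul_eq hW 0 0
      rw [mul_zero, add_zero, add_zero] at this
      exact ⟨_, this.symm⟩)
  rw [← map_pow] at key
  obtain ⟨⟨a', ha'⟩, b', hb'⟩ := dvd_of_C_dvd_linear (d := π ^ n) (a := a₁ - a) (b := b₁ - b) (by
    rw [← dvd_neg]
    convert key using 1
    simp only [map_sub]
    ring)
  refine ⟨a', b', ?_⟩
  have h2 := onLine_of_C_mul_eq hW a' b'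
  rw [← ha', ← hb', add_sub_cancel, add_sub_cancel] at h2
  rw [← h2, pow_succ, C_mul] at h₁
  exact (mul_dvd_mul_iff_left
    ((map_ne_zero_iff C (C_injective _ _)).2 (pow_ne_zero n hπ.ne_zero))).1 h₁

end Reduction

/-- A homogeneous quotient: if a form of degree `m` divides a form of degree `m + n`, the cofactor
can be chosen to be a form of degree `n`. -/
theorem exists_isHomogeneous_of_dvd {R σ : Type*} [CommRing R] {p q : MvPolynomial σ R} {m n : ℕ}
    (hp : p.IsHomogeneous m) (hq : q.IsHomogeneous (m + n)) (h : p ∣ q) :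
    ∃ r : MvPolynomial σ R, r.IsHomogeneous n ∧ q = p * r := by
  obtain ⟨r, rfl⟩ := h
  refine ⟨homogeneousComponent n r, homogeneousComponent_isHomogeneous n r, ?_⟩
  have h1 : homogeneousComponent (m + n) (p * r) = p * r := homogeneousComponent_eq_self hq
  rw [← h1]
  conv_lhs => rw [← sum_homogeneousComponent r, Finset.mul_sum, map_sum]
  have h2 (i : ℕ) : homogeneousComponent (m + n) (p * homogeneousComponent i r) =
      if i = n then p * homogeneousComponent i r else 0 := by
    rw [homogeneousComponent_of_mem ((mem_homogeneousSubmodule _ _).2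
      (hp.mul (homogeneousComponent_isHomogeneous i r)))]
    simp [eq_comm]
  simp only [h2, Finset.sum_ite_eq', Finset.mem_range]
  split_ifs with h3
  · rfl
  · rw [homogeneousComponent_eq_zero _ _ (by omega), mul_zero]

theorem exists_eq_linear {R : Type*} [CommRing R] {r : MvPolynomial (Fin 2) R}
    (hr : r.IsHomogeneous 1) : ∃ a b, r = C a * X 0 + C b * X 1 := by
  have h : r ∈ homogeneousSubmodule (Fin 2) R 1 := (mem_homogeneousSubmodule _ _).2 hr
  rw [homogeneousSubmodule_one_eq_span_X, Submodule.mem_span_range_iff_exists_fun] at h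
  obtain ⟨c, hc⟩ := h
  exact ⟨c 0, c 1, by rw [← hc, Fin.sum_univ_two, smul_eq_C_mul, smul_eq_C_mul]⟩

/-! ### Correctness and termination of the algorithm -/

section Algorithm

variable {O : Type*} [CommRing O] {π : O} {U W : MvPolynomial (Fin 3) O} {n : ℕ} {a b : O}

theorem onLine_zero_of_C_mul_eq (hW : C (π ^ n) * W = linSubst (shearMatrix (π ^ n) a b) U) :
    C (π ^ n) * f₃ W = onLine a b U := by
  rw [f₃_eq_onLine, onLine_of_C_mul_eq hW, mul_zero, add_zero, add_zero]

/-- If π divides f₃ of W, then U vanishes modulo π^(n+1) on the current line, so maximality of α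
bounds n. -/
theorem lt_of_atStep2 {α : ℕ} (hα' : ¬ HasLineMod π U (α + 1))
    (ha : π ∣ a) (hb : π ∣ b) (hW : C (π ^ n) * W = linSubst (shearMatrix (π ^ n) a b) U)
    (h3 : C π ∣ f₃ W) : n < α := by
  by_contra! hn
  refine hα' (HasLineMod.mono (n := n + 1) ⟨a, b, ha, hb, ?_⟩ (by omega))
  rw [← onLine_zero_of_C_mul_eq hW, pow_succ, C_mul]
  exact mul_dvd_mul_left _ h3

theorem le_of_atStep3 {α : ℕ} (hα' : ¬ HasLineMod π U (α + 1))
    (ha : π ∣ a) (hb : π ∣ b) (hW : C (π ^ n) * W = linSubst (shearMatrix (π ^ n) a b) U) :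
    n ≤ α := by
  by_contra! hn
  refine hα' (HasLineMod.mono (n := n) ⟨a, b, ha, hb, ?_⟩ (by omega))
  rw [← onLine_zero_of_C_mul_eq hW]
  exact dvd_mul_right _ _

variable [IsDomain O]

theorem isHomogeneous_of_C_mul_eq (hπ : Irreducible π) (hU : U.IsHomogeneous 3)
    (hW : C (π ^ n) * W = linSubst (shearMatrix (π ^ n) a b) U) : W.IsHomogeneous 3 := by
  intro d hd
  apply isHomogeneous_linSubst (shearMatrix (π ^ n) a b) hU
  rw [← hW, coeff_C_mul]
  exact mul_ne_zero (pow_ne_zero n hπ.ne_zero) hd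

variable [IsDiscreteValuationRing O]

/-- The cofactor can be taken to be a linear form over k, whose coefficients then lift to O. -/
theorem exists_red_f₃_eq (hW : W.IsHomogeneous 3) (h : red (f₂ W) ∣ red (f₃ W)) :
    ∃ a b : O, red (f₃ W) = red ((C a * X 0 + C b * X 1) * f₂ W) := by
  have h2 : (red (f₂ W)).IsHomogeneous 2 :=
    (hW.finSuccEquiv_coeff_isHomogeneous 1 2 rfl).map _
  have h3 : (red (f₃ W)).IsHomogeneous (2 + 1) :=
    (hW.finSuccEquiv_coeff_isHomogeneous 0 3 rfl).map _
  obtain ⟨r, hr, hr'⟩ := exists_isHomogeneous_of_dvd h2 h3 h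
  obtain ⟨a, b, rfl⟩ := exists_eq_linear hr
  obtain ⟨a, rfl⟩ := IsLocalRing.residue_surjective a
  obtain ⟨b, rfl⟩ := IsLocalRing.residue_surjective b
  refine ⟨a, b, ?_⟩
  rw [hr', mul_comm]
  simp [red]

/-- What holds for the states reached by the algorithm started on `U`, if it is to return `α`. -/
def AlgInvariant (π : O) (U : MvPolynomial (Fin 3) O) (α : ℕ) : AlgState O → Prop
  | .atStep2 W m => ∃ (n : ℕ) (a b : O), m = n ∧ π ∣ a ∧ π ∣ b ∧
      C (π ^ n) * W = linSubst (shearMatrix (π ^ n) a b) U ∧ C π ∣ f₃ W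
  | .atStep3 W m => ∃ (n : ℕ) (a b : O), m = n ∧ 1 ≤ n ∧ π ∣ a ∧ π ∣ b ∧
      C (π ^ n) * W = linSubst (shearMatrix (π ^ n) a b) U
  | .returned m => m = α

/-- Scaling turns n into n + 1; a substitution moves (a, b) by a multiple of π^n, which keeps both
divisible by π because n ≥ 1 at step (iii). -/
theorem AlgInvariant.step (hπ : Irreducible π) (hf₂ : ¬ C π ∣ f₂ U)
    {α : ℕ} (hα : HasLineMod π U α) (hα' : ¬ HasLineMod π U (α + 1)) {s t : AlgState O}
    (hs : AlgInvariant π U α s) (hst : AlgStep π s t) : AlgInvariant π U α t := by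
  cases hst with
  | scale W V m h =>
    obtain ⟨n, a, b, rfl, ha, hb, hW, h3⟩ := hs
    refine ⟨n + 1, a, b, by push_cast; rfl, by omega, ha, hb, ?_⟩
    rw [pow_succ, C_mul, mul_assoc, h, scaleX_eq_linSubst, ← linSubst_C_mul, hW, linSubst_linSubst,
      shearMatrix_mul]
    simp
  | subst W m a' b' hdvd h =>
    obtain ⟨n, a, b, rfl, hn, ha, hb, hW⟩ := hs
    refine ⟨n, a + π ^ n * a', b + π ^ n * b', rfl,
      dvd_add ha ((dvd_pow_self π (by omega)).mul_right _),
      dvd_add hb ((dvd_pow_self π (by omega)).mul_right _), ?_, ?_⟩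
    · rw [shear_eq_linSubst, ← linSubst_C_mul, hW, linSubst_linSubst, shearMatrix_mul, mul_one]
    · rw [f₃_eq_onLine, shear_eq_linSubst, onLine_linSubst, mul_zero, add_zero, add_zero,
        C_dvd_onLine_iff hπ fun i hi => C_dvd_xCoeff_of_C_mul_eq hπ hW hn hi]
      exact h
  | halt W m h =>
    obtain ⟨n, a, b, rfl, hn, ha, hb, hW⟩ := hs
    have hle := le_of_atStep3 hα' ha hb hW
    change (n : ℤ) = α
    rcases hle.lt_or_eq with hlt | rfl
    -- Stopping at n < α is impossible: U has a line modulo π^(n+1), so W has one modulo π and the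
    -- divisibility test succeeds.
    · exfalso
      obtain ⟨a', b', h'⟩ := exists_C_dvd_onLine hπ hf₂ ha hb hW (hα.mono hlt)
      rw [C_dvd_onLine_iff hπ fun i hi => C_dvd_xCoeff_of_C_mul_eq hπ hW hn hi] at h'
      apply h
      rw [h']
      simp only [red, map_mul]
      exact dvd_mul_left _ _
    · rfl

theorem AlgInvariant.exists_step_or_returned (hπ : Irreducible π) (hU : U.IsHomogeneous 3) {α : ℕ}
    {s : AlgState O} (hs : AlgInvariant π U α s) :
    (∃ t, AlgStep π s t) ∨ s = .returned α := by
  cases s with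
  | atStep2 W m =>
    left
    obtain ⟨n, a, b, rfl, ha, hb, hW, h3⟩ := hs
    obtain ⟨V, hV⟩ := C_dvd_linSubst_shearMatrix (a := 0) (b := 0) (f₃_eq_onLine W ▸ h3)
    exact ⟨_, .scale W V n (by rw [scaleX_eq_linSubst, hV])⟩
  | atStep3 W m =>
    left
    obtain ⟨n, a, b, rfl, hn, ha, hb, hW⟩ := hs
    by_cases h : red (f₂ W) ∣ red (f₃ W)
    · obtain ⟨a', b', h'⟩ := exists_red_f₃_eq (isHomogeneous_of_C_mul_eq hπ hU hW) h
      exact ⟨_, .subst W n a' b' h h'⟩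
    · exact ⟨_, .halt W n h⟩
  | returned m =>
    right
    rw [show m = α from hs]

/-- A bound for the number of steps left. -/
def stepsLeft (α : ℕ) : AlgState O → ℕ
  | .atStep2 _ m => 2 * (α - m).toNat + 1
  | .atStep3 _ m => 2 * (α - m).toNat + 2
  | .returned _ => 0

/-- A scaling lowers 2(α - m) by 2, which pays for the larger constant at step (iii). The bound m <
α at step (ii) prevents truncation in `toNat`. -/
theorem AlgInvariant.stepsLeft_lt {α : ℕ} (hα' : ¬ HasLineMod π U (α + 1)) {s t : AlgState O}
    (hs : AlgInvariant π U α s) (hst : AlgStep π s t) : stepsLeft α t < stepsLeft α s := by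
  cases hst with
  | scale W V m h =>
    obtain ⟨n, a, b, rfl, ha, hb, hW, h3⟩ := hs
    have := lt_of_atStep2 hα' ha hb hW h3
    simp only [stepsLeft]
    omega
  | subst W m a' b' hdvd h => simp [stepsLeft]
  | halt W m h => simp [stepsLeft]

theorem algComputes_of_hasLineMod (hπ : Irreducible π) (hU : U.IsHomogeneous 3)
    (hf₃ : C π ∣ f₃ U) (hf₂ : ¬ C π ∣ f₂ U) {α : ℕ} (hα : HasLineMod π U α)
    (hα' : ¬ HasLineMod π U (α + 1)) : AlgComputes π U α := by
  have h0 : AlgInvariant π U α (.atStep2 U 0) := by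
    refine ⟨0, 0, 0, rfl, dvd_zero _, dvd_zero _, ?_, hf₃⟩
    have : shearMatrix (π ^ 0) 0 0 = 1 := by
      ext i j
      fin_cases i <;> fin_cases j <;> simp [shearMatrix]
    rw [this, linSubst_one, pow_zero, C_1, one_mul]
  constructor
  · suffices ∀ (N : ℕ) (s : AlgState O), stepsLeft α s = N → AlgInvariant π U α s →
        Acc (fun t s => AlgStep π s t) s from this _ _ rfl h0
    intro N
    induction N using Nat.strong_induction_on with
    | _ N ih =>
      rintro s rfl hs
      exact ⟨_, fun t hst =>
        ih _ (hs.stepsLeft_lt hα' hst) t rfl (hs.step hπ hf₂ hα hα' hst)⟩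
  · intro s hs
    suffices AlgInvariant π U α s from this.exists_step_or_returned hπ hU
    induction hs with
    | refl => exact h0
    | tail _ hst ih => exact ih.step hπ hf₂ hα hα' hst

end Algorithm

/-! ### Evaluation, derivatives and changes of coordinates -/

section Points

variable {R : Type*} [CommRing R]

theorem eval_smul_of_isHomogeneous {σ : Type*} [Fintype σ] {φ : MvPolynomial σ R} {n : ℕ}
    (hφ : φ.IsHomogeneous n) (d : R) (v : σ → R) : eval (d • v) φ = d ^ n * eval v φ := by
  rw [eval_eq', eval_eq', Finset.mul_sum]
  refine Finset.sum_congr rfl fun m hm => ?_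
  have hm' : m.degree = n := by
    by_contra h
    exact (mem_support_iff.1 hm) (hφ.coeff_eq_zero h)
  simp only [Pi.smul_apply, smul_eq_mul, mul_pow, Finset.prod_mul_distrib,
    Finset.prod_pow_eq_pow_sum]
  rw [← hm', Finsupp.degree_eq_sum]
  ring

theorem finSuccEquiv_pderiv_zero (U : MvPolynomial (Fin 3) R) :
    finSuccEquiv R 2 (pderiv 0 U) = (finSuccEquiv R 2 U).derivative := by
  have h1 : finSuccEquiv R 2 (X 1) = Polynomial.C (X 0) := finSuccEquiv_X_succ (j := 0)
  have h2 : finSuccEquiv R 2 (X 2) = Polynomial.C (X 1) := finSuccEquiv_X_succ (j := 1)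
  induction U using MvPolynomial.induction_on with
  | C r => simp [finSuccEquiv_apply]
  | add p q hp hq => simp only [map_add, hp, hq]
  | mul_X p n hp =>
    fin_cases n <;> simp [Derivation.leibniz, hp, finSuccEquiv_X_zero, h1, h2, pderiv_X] <;> ring

theorem eval_vec_eq_eval (x y z : R) (U : MvPolynomial (Fin 3) R) :
    eval ![x, y, z] U = ((finSuccEquiv R 2 U).map (eval ![y, z])).eval x :=
  eval_eq_eval_mv_eval' ![y, z] x U

theorem eval_pderiv_zero (x y z : R) (U : MvPolynomial (Fin 3) R) :
    eval ![x, y, z] (pderiv 0 U) =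
      ((finSuccEquiv R 2 U).map (eval ![y, z])).derivative.eval x := by
  rw [eval_vec_eq_eval, finSuccEquiv_pderiv_zero, Polynomial.derivative_map]

theorem eval_pderiv_linSubst (g : Matrix (Fin 3) (Fin 3) R) (j : Fin 3) (U : MvPolynomial (Fin 3) R)
    (v : Fin 3 → R) : eval v (pderiv j (linSubst g U)) =
      ∑ i, g i j * eval (g.mulVec v) (pderiv i U) := by
  simp only [pderiv_linSubst, map_sum, map_mul, eval_C, eval_linSubst]

theorem onLine_swap12 (a b : R) (U : MvPolynomial (Fin 3) R) :
    aeval ![X 1, X 0] (onLine a b (linSubst !![1, 0, 0; 0, 0, 1; 0, 1, 0] U)) = onLine b a U := by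
  have : ((aeval ![X 1, X 0] : MvPolynomial (Fin 2) R →ₐ[R] MvPolynomial (Fin 2) R).comp
      (aeval ![-(C a * X 0 + C b * X 1), X 0, X 1])).comp
        (linSubst !![1, 0, 0; 0, 0, 1; 0, 1, 0]) = aeval ![-(C b * X 0 + C a * X 1), X 0, X 1] := by
    apply MvPolynomial.algHom_ext
    intro i
    fin_cases i <;> simp [linSubst, Fin.sum_univ_three, add_comm]
  exact congrArg (fun φ => φ U) this

/-- The line x = 0 in the new coordinates is x = s y + (t - s w) z in the old ones, once y ← y - w z
undoes the shift of y. -/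
theorem onLine_unipotent (s t w : R) (U : MvPolynomial (Fin 3) R) :
    aeval ![X 0 - C w * X 1, X 1] (onLine 0 0 (linSubst !![1, s, t; 0, 1, w; 0, 0, 1] U)) =
      onLine (-s) (s * w - t) U := by
  have : ((aeval ![X 0 - C w * X 1, X 1] :
      MvPolynomial (Fin 2) R →ₐ[R] MvPolynomial (Fin 2) R).comp
      (aeval ![-(C 0 * X 0 + C 0 * X 1), X 0, X 1])).comp
        (linSubst !![1, s, t; 0, 1, w; 0, 0, 1]) =
      aeval ![-(C (-s) * X 0 + C (s * w - t) * X 1), X 0, X 1] := by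
    apply MvPolynomial.algHom_ext
    intro i
    fin_cases i <;> simp [linSubst, Fin.sum_univ_three]
    ring
  exact congrArg (fun φ => φ U) this

end Points

/-! ### The value of max(|Z²|, |X|) at smooth points -/

section UnitRatio

variable {O : Type*} [CommRing O] [IsDomain O] [IsDiscreteValuationRing O]
  {K : Type*} [Field K] [Algebra O K] [IsFractionRing O K] {c : ℝ} {π : O}
  {U W : MvPolynomial (Fin 3) O}

theorem isUnit_of_not_dvd (hπ : Irreducible π) {x : O} (h : ¬ π ∣ x) : IsUnit x := by
  rw [← residue_eq_zero_iff_dvd hπ] at h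
  exact (IsLocalRing.residue_ne_zero_iff_isUnit x).1 h

variable [CharZero K]

/-- The case of a point with last coordinate `1`. -/
theorem covMax_eq_one_of_last_eq_one (hc : 1 < c) (hπ : Irreducible π) (hW : W.IsHomogeneous 3)
    {x y : O} (hv : eval ![x, y, 1] W = 0) (hd : ¬ π ∣ eval ![x, y, 1] (pderiv 0 W))
    (hl : ∀ a b, ¬ C π ∣ onLine a b W) :
    covMax O c (map (algebraMap O K) W) (algebraMap O K ∘ ![x, y, 1]) = 1 := by
  obtain ⟨e, he⟩ := (isUnit_of_not_dvd hπ hd).exists_right_inv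
  -- This slope, with e the inverse of ∂W/∂x, makes x = 0 the tangent at the point moved to (0:0:1),
  -- so the coefficient of y z² vanishes.
  set s := -(e * eval ![x, y, 1] (pderiv 1 W)) with hs
  set T : Matrix (Fin 3) (Fin 3) O := !![1, s, x; 0, 1, y; 0, 0, 1] with hT
  have hTdet : T.det = 1 := by simp [hT, Matrix.det_fin_three]
  have hTv : T.mulVec ![0, 0, 1] = ![x, y, 1] := by
    ext i
    fin_cases i <;> simp [hT, Matrix.mulVec, dotProduct, Fin.sum_univ_three]
  obtain ⟨A, B, c₀, f, g, h, i₀, j, k, m, hV⟩ := exists_eq_cubic (isHomogeneous_linSubst T hW)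
  have hc₀ : c₀ = 0 := by
    have := eval_linSubst T ![0, 0, 1] W
    rw [hTv, hv, hV] at this
    simpa [cubic] using this
  have hg : g = eval ![x, y, 1] (pderiv 0 W) := by
    have := eval_pderiv_linSubst T 0 W ![0, 0, 1]
    rw [hTv, hV, Fin.sum_univ_three, show T 0 0 = 1 from rfl, show T 1 0 = 0 from rfl,
      show T 2 0 = 0 from rfl] at this
    simpa [cubic, pderiv_X, Derivation.leibniz, Derivation.leibniz_pow] using this
  have hi₀ : i₀ = 0 := by
    have := eval_pderiv_linSubst T 1 W ![0, 0, 1]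
    rw [hTv, hV, Fin.sum_univ_three, show T 0 1 = s from rfl, show T 1 1 = 1 from rfl,
      show T 2 1 = 0 from rfl] at this
    have h1 : i₀ = s * eval ![x, y, 1] (pderiv 0 W) + eval ![x, y, 1] (pderiv 1 W) := by
      simpa [cubic, pderiv_X, Derivation.leibniz, Derivation.leibniz_pow] using this
    rw [h1, hs]
    linear_combination (-eval ![x, y, 1] (pderiv 1 W)) * he
  subst hc₀ hi₀
  have hgu : IsUnit g := hg ▸ isUnit_of_not_dvd hπ hd
  -- On x = 0 the new cubic is B y³ + f y² z; were it zero modulo π, a line excluded by `hl` would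
  -- lie on the reduction of W.
  have hfb : ¬ (π ∣ f ∧ π ∣ B) := by
    rintro ⟨⟨f', rfl⟩, B', rfl⟩
    apply hl (-s) (s * y - x)
    rw [← onLine_unipotent, ← hT, hV]
    have : onLine 0 0 (cubic A (π * B') 0 (π * f') g h 0 j k m) =
        C π * (C B' * X 0 ^ 3 + C f' * (X 0 ^ 2 * X 1)) := by
      simp [onLine, cubic]
      ring
    rw [this, map_mul, algHom_C]
    exact dvd_mul_right _ _
  have hcov := covMax_unimodular (K := K) hc T (by rw [hTdet]; exact isUnit_one) W ![0, 0, 1]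
    (by rw [hTv, hv]) (by
      obtain ⟨r, hr⟩ := b₂_unipotent (algebraMap O K) s x y hW
      exact ⟨r, by rw [hTdet, map_one, one_pow, one_mul]; exact hr⟩)
  rw [hTv] at hcov
  have h001 : algebraMap O K ∘ ![0, 0, 1] = ![0, 0, 1] := by
    ext i
    fin_cases i <;> simp
  rw [← hcov, hV, map_cubic, map_zero, h001, covMax, eval_covZ_cubic, eval_covX_cubic]
  simp only [← map_pow, ← map_mul, ← map_sub, ← map_add]
  apply le_antisymm (max_le (absVal_algebraMap_le_one hc _) (absVal_algebraMap_le_one hc _))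
  -- If f is a unit then so is Z = f g²; otherwise B is a unit and X ≡ B² g⁶ (mod π).
  by_cases hf : π ∣ f
  · have hB : ¬ π ∣ B := fun hB => hfb ⟨hf, hB⟩
    refine le_max_of_le_right (absVal_algebraMap_of_isUnit hc ((hgu.pow 5).mul ?_)).ge
    apply isUnit_of_not_dvd hπ
    intro hdvd
    have h1 : π ∣ B ^ 2 * g := by
      have h2 : π ∣ f * (f * k - B * m) := hf.mul_right _
      rw [show B ^ 2 * g - B * f * m + f ^ 2 * k = B ^ 2 * g + f * (f * k - B * m) by ring] at hdvd
      exact (dvd_add_left h2).1 hdvd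
    exact hB (hπ.prime.dvd_of_dvd_pow ((hgu.dvd_mul_right).1 h1))
  · have hfu := isUnit_of_not_dvd hπ hf
    exact le_max_of_le_left
      (absVal_algebraMap_of_isUnit hc ((hfu.mul (hgu.pow 2)).pow 2)).ge

theorem covMax_eq_one_of_last_isUnit (hc : 1 < c) (hπ : Irreducible π) (hW : W.IsHomogeneous 3)
    {x y z : O} (hz : IsUnit z) (hv : eval ![x, y, z] W = 0)
    (hd : ¬ π ∣ eval ![x, y, z] (pderiv 0 W)) (hl : ∀ a b, ¬ C π ∣ onLine a b W) :
    covMax O c (map (algebraMap O K) W) (algebraMap O K ∘ ![x, y, z]) = 1 := by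
  obtain ⟨e, he⟩ := hz.exists_right_inv
  have hsm : ![x, y, z] = z • ![e * x, e * y, 1] := by
    ext i
    fin_cases i
    · simp [← mul_assoc, he]
    · simp [← mul_assoc, he]
    · simp
  rw [hsm, eval_smul_of_isHomogeneous hW] at hv
  rw [hsm, eval_smul_of_isHomogeneous (IsHomogeneous.pderiv hW)] at hd
  have hv' : eval ![e * x, e * y, 1] W = 0 := (hz.pow 3).mul_right_eq_zero.1 hv
  have key := covMax_eq_one_of_last_eq_one (K := K) hc hπ hW hv' (fun h => hd (h.mul_left _)) hl
  have hsm' : algebraMap O K ∘ ![x, y, z] =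
      algebraMap O K z • (algebraMap O K ∘ ![e * x, e * y, 1]) := by
    rw [hsm]
    ext i
    simp only [Function.comp_apply, Pi.smul_apply, smul_eq_mul, map_mul]
  rw [hsm', covMax_smul hc (hW.map _) (by rw [← map_eval, hv', map_zero])
    (by simpa using hz.ne_zero), key, absVal_algebraMap_of_isUnit hc hz]
  simp

theorem covMax_eq_one (hc : 1 < c) (hπ : Irreducible π) (hW : W.IsHomogeneous 3)
    {x y z : O} (hyz : IsUnit y ∨ IsUnit z) (hv : eval ![x, y, z] W = 0)
    (hd : ¬ π ∣ eval ![x, y, z] (pderiv 0 W)) (hl : ∀ a b, ¬ C π ∣ onLine a b W) :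
    covMax O c (map (algebraMap O K) W) (algebraMap O K ∘ ![x, y, z]) = 1 := by
  rcases hyz with hy | hz
  · set P : Matrix (Fin 3) (Fin 3) O := !![1, 0, 0; 0, 0, 1; 0, 1, 0] with hP
    have hPv : P.mulVec ![x, z, y] = ![x, y, z] := by
      ext i
      fin_cases i <;> simp [hP, Matrix.mulVec, dotProduct, Fin.sum_univ_three]
    have hPdet : P.det = -1 := by simp [hP, Matrix.det_fin_three]
    have hPK : P.map (algebraMap O K) = !![1, 0, 0; 0, 0, 1; 0, 1, 0] := by
      ext i j
      fin_cases i <;> fin_cases j <;> simp [hP]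
    have hcov := covMax_unimodular (K := K) hc P (by rw [hPdet]; exact isUnit_one.neg) W ![x, z, y]
      (by rw [hPv, hv]) ⟨0, by
        rw [hPdet, map_linSubst, hPK, b₂_swap12 (hW.map _)]
        simp⟩
    rw [hPv] at hcov
    rw [← hcov]
    apply covMax_eq_one_of_last_isUnit hc hπ (isHomogeneous_linSubst P hW) hy
    · rw [eval_linSubst, hPv, hv]
    · rw [eval_pderiv_linSubst, hPv, Fin.sum_univ_three, show P 0 0 = 1 from rfl,
        show P 1 0 = 0 from rfl, show P 2 0 = 0 from rfl]
      simpa using hd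
    · intro a b h
      apply hl b a
      rw [← onLine_swap12]
      obtain ⟨V, hV⟩ := h
      rw [← hP, hV, map_mul, algHom_C]
      exact dvd_mul_right _ _
  · exact covMax_eq_one_of_last_isUnit hc hπ hW hz hv hd hl

theorem covMax_eq_absVal_pow (hc : 1 < c) (hπ : Irreducible π) (hU : U.IsHomogeneous 3) {α : ℕ}
    (hα₁ : 1 ≤ α) (hα : HasLineMod π U α) (hα' : ¬ HasLineMod π U (α + 1)) {x y z : O}
    (hx : π ∣ x) (hyz : IsUnit y ∨ IsUnit z) (hv : eval ![x, y, z] U = 0)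
    (hd : ¬ π ∣ eval ![x, y, z] (pderiv 0 U)) :
    covMax O c (map (algebraMap O K) U) (algebraMap O K ∘ ![x, y, z]) =
      absVal O c (algebraMap O K π) ^ (2 * α) := by
  obtain ⟨a, b, ha, hb, hab⟩ := hα
  obtain ⟨W, hW⟩ := C_dvd_linSubst_shearMatrix hab
  replace hW := hW.symm
  -- For fixed y, z both x and -(a y + b z) are roots of U modulo π^α, congruent modulo π, and x is
  -- simple.
  have hx' : π ^ α ∣ -(a * y + b * z) - x := by
    apply pow_dvd_sub_of_derivative_not_dvd hπ.prime ((finSuccEquiv O 2 U).map (eval ![y, z]))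
    · exact dvd_sub (dvd_add (ha.mul_right _) (hb.mul_right _)).neg_right hx
    · rwa [← eval_pderiv_zero]
    · rw [← eval_vec_eq_eval, ← eval_vec_eq_eval, hv, sub_zero, ← eval_onLine]
      obtain ⟨q, hq⟩ := hab
      rw [hq, map_mul, eval_C]
      exact dvd_mul_right _ _
  obtain ⟨x', hx'⟩ := hx'
  have hSv : (shearMatrix (π ^ α) a b).mulVec ![-x', y, z] = ![x, y, z] := by
    rw [mulVec_shearMatrix]
    congr 1
    linear_combination hx'
  have hπα : π ^ α ≠ 0 := pow_ne_zero α hπ.ne_zero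
  have hWv : eval ![-x', y, z] W = 0 := by
    have := congrArg (eval ![-x', y, z]) hW
    rw [eval_linSubst, hSv, hv, map_mul, eval_C] at this
    exact (mul_eq_zero_iff_left hπα).1 this
  have hWd : eval ![-x', y, z] (pderiv 0 W) = eval ![x, y, z] (pderiv 0 U) := by
    have := eval_pderiv_linSubst (shearMatrix (π ^ α) a b) 0 U ![-x', y, z]
    rw [← hW, pderiv_C_mul, map_mul, eval_C, hSv, Fin.sum_univ_three,
      show shearMatrix (π ^ α) a b 0 0 = π ^ α from rfl,
      show shearMatrix (π ^ α) a b 1 0 = 0 from rfl,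
      show shearMatrix (π ^ α) a b 2 0 = 0 from rfl, zero_mul, zero_mul, add_zero, add_zero] at this
    exact mul_left_cancel₀ hπα this
  have hWl (a' b' : O) : ¬ C π ∣ onLine a' b' W := by
    intro h
    refine hα' ⟨a + π ^ α * a', b + π ^ α * b',
      dvd_add ha ((dvd_pow_self π (by omega)).mul_right _),
      dvd_add hb ((dvd_pow_self π (by omega)).mul_right _), ?_⟩
    rw [← onLine_of_C_mul_eq hW, pow_succ, C_mul]
    exact mul_dvd_mul_left _ h
  have key := covMax_eq_one (K := K) hc hπ (isHomogeneous_of_C_mul_eq hπ hU hW) hyz hWv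
    (hWd ▸ hd) hWl
  set p : K := algebraMap O K (π ^ α) with hp
  have hp0 : p ≠ 0 := (map_ne_zero_iff _ (IsFractionRing.injective O K)).2 hπα
  set S := (shearMatrix (π ^ α) a b).map (algebraMap O K) with hS
  have hSdet : S.det = p := by
    have := (algebraMap O K).map_det (shearMatrix (π ^ α) a b)
    rw [det_shearMatrix] at this
    exact this.symm
  have hSv' : S.mulVec (algebraMap O K ∘ ![-x', y, z]) = algebraMap O K ∘ ![x, y, z] := by
    rw [← hSv]
    ext i
    simp [hS, Matrix.mulVec, dotProduct]
  have hWK : map (algebraMap O K) W = C p⁻¹ * linSubst S (map (algebraMap O K) U) := by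
    rw [hS, ← map_linSubst, ← hW, map_mul, map_C, ← hp, ← mul_assoc, ← C_mul,
      inv_mul_cancel₀ hp0, C_1, one_mul]
  have hb₂ : ∃ r, b₂ (C p⁻¹ * linSubst S (map (algebraMap O K) U)) =
      (p⁻¹ * S.det) ^ 2 * b₂ (map (algebraMap O K) U) + 12 * algebraMap O K r := by
    obtain ⟨r, hr⟩ := b₂_unipotent (algebraMap O K) (-a) (-b) 0 hU
    -- The diagonal factor scales b₂ by p², which t = p⁻¹ cancels; only the integral shear
    -- contributes a multiple of 12.
    have hSS : S = (shearMatrix 1 a b).map (algebraMap O K) * !![p, 0, 0; 0, 1, 0; 0, 0, 1] := by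
      ext i j
      fin_cases i <;> fin_cases j <;> simp [hS, hp, shearMatrix, Matrix.mul_apply,
        Fin.sum_univ_three]
    refine ⟨r, ?_⟩
    rw [b₂_C_mul, hSdet, hSS, ← linSubst_linSubst, ← map_linSubst,
      b₂_diagonal _ ((isHomogeneous_linSubst _ hU).map _), shearMatrix, hr]
    field_simp
  have h1 := covMax_linSubst (O := O) hc p⁻¹ S
    (by rw [hSdet, inv_mul_cancel₀ hp0, absVal_one]) (map (algebraMap O K) U)
    (algebraMap O K ∘ ![-x', y, z]) (by rw [hSv', ← map_eval, hv, map_zero]) hb₂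
  rw [← hWK, key, hSv'] at h1
  have h2 : absVal O c p * absVal O c p⁻¹ = 1 := by
    rw [← absVal_mul hc, mul_inv_cancel₀ hp0, absVal_one]
  have h3 : absVal O c p = absVal O c (algebraMap O K π) ^ α := by
    rw [hp, map_pow, absVal_pow hc]
  rw [mul_comm 2 α, pow_mul, ← h3]
  linear_combination (-(absVal O c p) ^ 2) * h1 + covMax O c (map (algebraMap O K) U)
    (algebraMap O K ∘ ![x, y, z]) * (-(absVal O c p * absVal O c p⁻¹) - 1) * h2

end UnitRatio

/-! ### Smoothness under substitution, and cubics containing a line -/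

section Smooth

variable {F L : Type*} [Field F] [Field L] [Algebra F L]

theorem aeval_eq_eval_map' (q : Fin 3 → L) (U : MvPolynomial (Fin 3) F) :
    aeval q U = eval q (map (algebraMap F L) U) := by
  rw [aeval_def, eval₂_eq_eval_map]

/-- By the chain rule the gradient is multiplied by an invertible matrix, so it cannot become zero.
-/
theorem isSmoothPoint_linSubst {g : Matrix (Fin 3) (Fin 3) F} (hg : g.det ≠ 0)
    {U : MvPolynomial (Fin 3) F} {q : Fin 3 → L}
    (h : IsSmoothPoint U ((g.map (algebraMap F L)).mulVec q)) :
    IsSmoothPoint (linSubst g U) q := by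
  obtain ⟨h0, hU, i, hi⟩ := h
  refine ⟨?_, ?_, ?_⟩
  · rintro rfl
    simp at h0
  · rwa [aeval_eq_eval_map', map_linSubst, eval_linSubst, ← aeval_eq_eval_map']
  · by_contra! hall
    have hdet : (g.map (algebraMap F L)).det ≠ 0 := by
      have := (algebraMap F L).map_det g
      rw [RingHom.mapMatrix_apply] at this
      rw [← this]
      simpa using hg
    have hz := Matrix.eq_zero_of_vecMul_eq_zero hdet
      (v := fun i => aeval ((g.map (algebraMap F L)).mulVec q) (pderiv i U)) (by
        ext j
        have := hall j
        rw [aeval_eq_eval_map', ← pderiv_map, map_linSubst, eval_pderiv_linSubst] at this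
        simp only [pderiv_map, ← aeval_eq_eval_map'] at this
        simpa [Matrix.vecMul, dotProduct, mul_comm] using this)
    exact hi (congrFun hz i)

theorem IsNonsingular.linSubst {g : Matrix (Fin 3) (Fin 3) F} (hg : g.det ≠ 0)
    {U : MvPolynomial (Fin 3) F} (hU : IsNonsingular U) : IsNonsingular (linSubst g U) := by
  intro q hq hqU
  apply isSmoothPoint_linSubst hg
  rw [aeval_eq_eval_map', map_linSubst, eval_linSubst, ← aeval_eq_eval_map'] at hqU
  refine hU _ (fun h0 => hq ?_) hqU
  refine Matrix.eq_zero_of_mulVec_eq_zero ?_ h0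
  have := (algebraMap F (AlgebraicClosure F)).map_det g
  rw [RingHom.mapMatrix_apply] at this
  rw [← this]
  simpa using hg

theorem exists_quadraticForm_zero [IsAlgClosed L] [CharZero L] (k m g : L) :
    ∃ y z : L, (y ≠ 0 ∨ z ≠ 0) ∧ k * y ^ 2 + m * y * z + g * z ^ 2 = 0 := by
  by_cases hk : k = 0
  · exact ⟨1, 0, Or.inl one_ne_zero, by simp [hk]⟩
  · obtain ⟨s, hs⟩ := IsAlgClosed.exists_pow_nat_eq (m ^ 2 - 4 * k * g) (n := 2) (by norm_num)
    refine ⟨(s - m) / (2 * k), 1, Or.inr one_ne_zero, ?_⟩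
    field_simp
    linear_combination hs

/-- A binary cubic with four distinct zeros is zero, so V = x Q. Over the algebraic closure Q has a
zero on the line x = 0, and V is singular there. -/
theorem not_isNonsingular_of_line [CharZero F] {V : MvPolynomial (Fin 3) F}
    (hV : V.IsHomogeneous 3) (h10 : eval ![0, 1, 0] V = 0) (h01 : eval ![0, 0, 1] V = 0)
    (h11 : eval ![0, 1, 1] V = 0) (h12 : eval ![0, 1, -1] V = 0) : ¬ IsNonsingular V := by
  intro hns
  obtain ⟨a, b, c, f, g, h, i, j, k, m, rfl⟩ := exists_eq_cubic hV
  have hb : b = 0 := by simpa [cubic] using h10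
  have hc : c = 0 := by simpa [cubic] using h01
  subst hb hc
  have h1 : f + i = 0 := by simpa [cubic] using h11
  have h2 : -f + i = 0 := by simpa [cubic] using h12
  have hf : f = 0 := by
    have : (2 : F) * f = 0 := by linear_combination h1 - h2
    simpa using this
  have hi : i = 0 := by linear_combination h1 - hf
  subst hf hi
  have : CharZero (AlgebraicClosure F) := charZero_of_injective_algebraMap
    (algebraMap F (AlgebraicClosure F)).injective
  let φ := algebraMap F (AlgebraicClosure F)
  obtain ⟨y, z, hyz, he⟩ := exists_quadraticForm_zero (φ k) (φ m) (φ g)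
  have hq : (![0, y, z] : Fin 3 → AlgebraicClosure F) ≠ 0 := by
    intro h0
    have hy : y = 0 := congrFun h0 1
    have hz : z = 0 := congrFun h0 2
    simp [hy, hz] at hyz
  obtain ⟨-, -, n, hn⟩ := hns ![0, y, z] hq (by simp [cubic])
  apply hn
  rw [aeval_eq_eval_map', ← pderiv_map, map_cubic]
  fin_cases n
  · simp [cubic, pderiv_X, Derivation.leibniz, Derivation.leibniz_pow]
    linear_combination he
  · simp [cubic, pderiv_X, Derivation.leibniz, Derivation.leibniz_pow]
  · simp [cubic, pderiv_X, Derivation.leibniz, Derivation.leibniz_pow]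

end Smooth

/-! ### Boundedness of n by compactness -/

section Compactness

/-- If `U` is small on the lines `x + aₙ y + bₙ z = 0` with bounded coefficients, then it vanishes
on a limit of these lines. -/
theorem exists_limit_line {K : Type*} [NormedField K] [ProperSpace K] (a b : ℕ → K)
    (ha : ∀ n, ‖a n‖ ≤ 1) (hb : ∀ n, ‖b n‖ ≤ 1) (U : MvPolynomial (Fin 3) K) (S : Set K)
    {r : ℝ} (hr0 : 0 ≤ r) (hr : r < 1)
    (h : ∀ n, ∀ y ∈ S, ∀ z ∈ S, ‖eval ![-(a n * y + b n * z), y, z] U‖ ≤ r ^ n) :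
    ∃ a b : K, ∀ y ∈ S, ∀ z ∈ S, eval ![-(a * y + b * z), y, z] U = 0 := by
  have hK : IsCompact (Metric.closedBall (0 : K) 1 ×ˢ Metric.closedBall (0 : K) 1) :=
    (isCompact_closedBall _ _).prod (isCompact_closedBall _ _)
  obtain ⟨⟨a₀, b₀⟩, -, φ, hφ, hlim⟩ := hK.tendsto_subseq (x := fun n => (a n, b n))
    (fun n => ⟨by simpa using ha n, by simpa using hb n⟩)
  refine ⟨a₀, b₀, fun y hy z hz => ?_⟩
  have hcont : Continuous fun t : K × K => eval ![-(t.1 * y + t.2 * z), y, z] U := by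
    refine (MvPolynomial.continuous_eval U).comp (continuous_pi fun i => ?_)
    fin_cases i
    · change Continuous fun t : K × K => -(t.1 * y + t.2 * z)
      fun_prop
    · exact continuous_const
    · exact continuous_const
  have h1 := (hcont.tendsto (a₀, b₀)).comp hlim
  have h2 : Filter.Tendsto (fun n => eval ![-(a (φ n) * y + b (φ n) * z), y, z] U) Filter.atTop
      (nhds 0) :=
    squeeze_zero_norm (fun n => h (φ n) y hy z hz)
      ((tendsto_pow_atTop_nhds_zero_of_lt_one hr0 hr).comp hφ.tendsto_atTop)
  exact tendsto_nhds_unique h1 h2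

variable (p : ℕ) [Fact p.Prime] (K : Type*) [Field K] [Algebra ℚ_[p] K]
  [Algebra ℤ_[p] K] [IsScalarTower ℤ_[p] ℚ_[p] K]

theorem spectralNorm_le_one (x : integralClosure ℤ_[p] K) :
    spectralNorm ℚ_[p] K (x : K) ≤ 1 := by
  have hx : IsIntegral ℤ_[p] (x : K) := x.2
  have hmin := minpoly.isIntegrallyClosed_eq_field_fractions' ℚ_[p] hx
  rw [spectralNorm, spectralValue_le_one_iff (minpoly.monic hx.tower_top)]
  intro n
  rw [hmin, Polynomial.coeff_map]
  exact PadicInt.norm_le_one _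

variable [FiniteDimensional ℚ_[p] K]

/-- Otherwise π⁻¹ would have norm at most 1, hence be integral, and π would be a unit. -/
theorem spectralNorm_lt_one {π : integralClosure ℤ_[p] K} (hπ : Irreducible π) :
    spectralNorm ℚ_[p] K (π : K) < 1 := by
  by_contra! h1
  have h0 : (π : K) ≠ 0 := by simpa using hπ.ne_zero
  have hm := map_mul (spectralMulAlgNorm ℚ_[p] K) (π : K) (π : K)⁻¹
  rw [mul_inv_cancel₀ h0, map_one] at hm
  simp only [spectralMulAlgNorm_def] at hm
  have hn : 0 ≤ spectralNorm ℚ_[p] K (π : K)⁻¹ := spectralNorm_nonneg _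
  have hinv : IsIntegral ℤ_[p] (π : K)⁻¹ :=
    isIntegral_padicInt_of_spectralNorm_le_one p K _ (by nlinarith)
  apply hπ.not_isUnit
  refine IsUnit.of_mul_eq_one ⟨(π : K)⁻¹, hinv⟩ (Subtype.ext ?_)
  exact mul_inv_cancel₀ h0

/-- Lines for every n have coefficients in the compact unit ball; a limit line lies on the curve at
all integral y, z, and four such points already contradict nonsingularity. -/
theorem exists_not_hasLineMod {π : integralClosure ℤ_[p] K} (hπ : Irreducible π)
    {U : MvPolynomial (Fin 3) (integralClosure ℤ_[p] K)} (hU : U.IsHomogeneous 3)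
    (hns : IsNonsingular (map (algebraMap (integralClosure ℤ_[p] K) K) U)) :
    ∃ N, ¬ HasLineMod π U N := by
  by_contra! hall
  choose a b ha hb hab using hall
  set φ := algebraMap (integralClosure ℤ_[p] K) K with hφ
  have hlim : ∃ a b : K, ∀ y ∈ Set.range φ, ∀ z ∈ Set.range φ,
      eval ![-(a * y + b * z), y, z] (map φ U) = 0 := by
    -- The norm is local to this step: the conclusion about the limit line is purely algebraic.
    let : NormedField K := spectralNorm.normedField ℚ_[p] K
    let : NormedAlgebra ℚ_[p] K := spectralNorm.normedAlgebra ℚ_[p] K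
    have : ProperSpace K := FiniteDimensional.proper ℚ_[p] K
    refine exists_limit_line (fun n => φ (a n)) (fun n => φ (b n))
      (fun n => spectralNorm_le_one p K (a n)) (fun n => spectralNorm_le_one p K (b n)) _ _
      (r := ‖(π : K)‖) (norm_nonneg _) (spectralNorm_lt_one p K hπ) ?_
    rintro n _ ⟨y, rfl⟩ _ ⟨z, rfl⟩
    obtain ⟨V, hV⟩ := hab n
    have e : eval ![-(φ (a n) * φ y + φ (b n) * φ z), φ y, φ z] (map φ U) =
        φ (π ^ n * eval ![y, z] V) := by
      have h1 := eval_onLine (a n) (b n) y z U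
      rw [hV, map_mul, eval_C] at h1
      rw [h1, map_eval]
      congr 2
      ext i
      fin_cases i <;> simp
    rw [e, map_mul, map_pow, norm_mul, norm_pow]
    exact mul_le_of_le_one_right (pow_nonneg (norm_nonneg _) _) (spectralNorm_le_one p K _)
  obtain ⟨a, b, hab⟩ := hlim
  have : CharZero K := charZero_of_injective_algebraMap (algebraMap ℚ_[p] K).injective
  have hV (y z : K) (hy : y ∈ Set.range φ) (hz : z ∈ Set.range φ) :
      eval ![0, y, z] (linSubst (shearMatrix 1 a b) (map φ U)) = 0 := by
    rw [eval_linSubst, mulVec_shearMatrix,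
      show 1 * 0 - a * y - b * z = -(a * y + b * z) by ring]
    exact hab y hy z hz
  have h0 : (0 : K) ∈ Set.range φ := ⟨0, map_zero _⟩
  have h1 : (1 : K) ∈ Set.range φ := ⟨1, map_one _⟩
  have h2 : (-1 : K) ∈ Set.range φ := ⟨-1, by simp⟩
  exact not_isNonsingular_of_line (isHomogeneous_linSubst _ (hU.map _)) (hV 1 0 h1 h0)
    (hV 0 1 h0 h1) (hV 1 1 h1 h1) (hV 1 (-1) h1 h2)
    (hns.linSubst (by rw [det_shearMatrix]; exact one_ne_zero))

end Compactness

/-! ### General lines and reduction to x = 0 -/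

theorem isHomogeneous_one_eq {R : Type*} [CommRing R] {r : MvPolynomial (Fin 3) R}
    (hr : r.IsHomogeneous 1) : ∃ l₀ l₁ l₂, r = C l₀ * X 0 + C l₁ * X 1 + C l₂ * X 2 := by
  have h : r ∈ homogeneousSubmodule (Fin 3) R 1 := (mem_homogeneousSubmodule _ _).2 hr
  rw [homogeneousSubmodule_one_eq_span_X, Submodule.mem_span_range_iff_exists_fun] at h
  obtain ⟨c, hc⟩ := h
  exact ⟨c 0, c 1, c 2, by
    rw [← hc, Fin.sum_univ_three, smul_eq_C_mul, smul_eq_C_mul, smul_eq_C_mul]⟩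

theorem IsLineOfMultiplicityOne.linSubst {k : Type*} [Field k] {V ℓ : MvPolynomial (Fin 3) k}
    (h : IsLineOfMultiplicityOne V ℓ) {g g' : Matrix (Fin 3) (Fin 3) k} (hg : g * g' = 1) :
    IsLineOfMultiplicityOne (linSubst g V) (linSubst g ℓ) := by
  have hinv (W : MvPolynomial (Fin 3) k) :
      TernaryCubic.linSubst g' (TernaryCubic.linSubst g W) = W := by
    rw [linSubst_linSubst, hg, linSubst_one]
  obtain ⟨h0, h1, h2, h3⟩ := h
  refine ⟨fun h => h0 ?_, isHomogeneous_linSubst g h1, map_dvd _ h2, fun h => h3 ?_⟩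
  · rw [← hinv ℓ, h, map_zero]
  · have := map_dvd (TernaryCubic.linSubst g') h
    rwa [map_pow, hinv, hinv] at this

section DVR

variable {O : Type*} [CommRing O] [IsDomain O] [IsDiscreteValuationRing O]
  {K : Type*} [Field K] [Algebra O K] [IsFractionRing O K] {c : ℝ} {π : O}
  {U : MvPolynomial (Fin 3) O}

theorem coeff_finSuccEquiv_red (U : MvPolynomial (Fin 3) O) (i : ℕ) :
    (finSuccEquiv _ 2 (red U)).coeff i = red (xCoeff U i) := by
  ext m
  rw [finSuccEquiv_coeff_coeff, red, red, coeff_map, coeff_map, xCoeff, finSuccEquiv_coeff_coeff]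

theorem X_zero_pow_dvd_red_iff (hπ : Irreducible π) (n : ℕ) :
    X 0 ^ n ∣ red U ↔ ∀ i < n, C π ∣ xCoeff U i := by
  rw [← map_dvd_iff (finSuccEquiv (IsLocalRing.ResidueField O) 2), map_pow, finSuccEquiv_X_zero,
    Polynomial.X_pow_dvd_iff]
  simp only [coeff_finSuccEquiv_red, C_dvd_iff_red_eq_zero hπ]

theorem isLineOfMultiplicityOne_X_zero (hπ : Irreducible π) {d : IsLocalRing.ResidueField O}
    (hd : d ≠ 0) (h : IsLineOfMultiplicityOne (red U) (C d * X 0)) :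
    C π ∣ f₃ U ∧ ¬ C π ∣ f₂ U := by
  have hu : IsUnit (C d : MvPolynomial (Fin 3) (IsLocalRing.ResidueField O)) :=
    (isUnit_iff_ne_zero.2 hd).map C
  obtain ⟨-, -, h1, h2⟩ := h
  rw [hu.mul_left_dvd, ← pow_one (X 0), X_zero_pow_dvd_red_iff hπ] at h1
  rw [mul_pow, (hu.pow 2).mul_left_dvd, X_zero_pow_dvd_red_iff hπ] at h2
  have h3 : C π ∣ f₃ U := h1 0 (by norm_num)
  refine ⟨h3, fun h => h2 fun i hi => ?_⟩
  interval_cases i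
  · exact h3
  · exact h

/-- The ratio is `|π| ^ (2 α)` at the points with primitive integral coordinates. -/
def HasRatio (K : Type*) [Field K] [Algebra O K] [IsFractionRing O K] (c : ℝ) (π : O)
    (U : MvPolynomial (Fin 3) O) (ℓ : MvPolynomial (Fin 3) (IsLocalRing.ResidueField O)) (α : ℤ) :
    Prop :=
  ∀ u : Fin 3 → O, eval u U = 0 → eval (IsLocalRing.residue O ∘ u) ℓ = 0 →
    IsSmoothPoint (red U) (IsLocalRing.residue O ∘ u) →
    covMax O c (map (algebraMap O K) U) (algebraMap O K ∘ u) =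
      absVal O c (algebraMap O K π) ^ (2 * α)

theorem aeval_residue (u : Fin 3 → O) (U : MvPolynomial (Fin 3) O) :
    aeval (IsLocalRing.residue O ∘ u) (red U) = IsLocalRing.residue O (eval u U) := by
  rw [red, map_eval]
  rfl

variable [CharZero K]

theorem exists_hasRatio_X_zero (hc : 1 < c) (hπ : Irreducible π) (hU : U.IsHomogeneous 3)
    (hN : ∃ N, ¬ HasLineMod π U N) {d : IsLocalRing.ResidueField O} (hd : d ≠ 0)
    (hℓ : IsLineOfMultiplicityOne (red U) (C d * X 0)) :
    ∃ α : ℤ, HasRatio K c π U (C d * X 0) α ∧ AlgComputes π U α := by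
  obtain ⟨hf₃, hf₂⟩ := isLineOfMultiplicityOne_X_zero hπ hd hℓ
  have h1 : HasLineMod π U 1 :=
    ⟨0, 0, dvd_zero _, dvd_zero _, by rwa [pow_one, ← f₃_eq_onLine]⟩
  -- α is a place where the property stops; it exists because n = 1 holds and some N fails.
  obtain ⟨α, hα₁, hα, hα'⟩ : ∃ α, 1 ≤ α ∧ HasLineMod π U α ∧ ¬ HasLineMod π U (α + 1) := by
    by_contra! hall
    obtain ⟨N, hN⟩ := hN
    have (n : ℕ) : HasLineMod π U (n + 1) := by
      induction n with
      | zero => exact h1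
      | succ n ih => exact hall (n + 1) (by omega) ih
    exact hN ((this N).mono (by omega))
  refine ⟨α, fun u hu huℓ hsm => ?_, algComputes_of_hasLineMod hπ hU hf₃ hf₂ hα hα'⟩
  obtain ⟨x, y, z, rfl⟩ : ∃ x y z, u = ![x, y, z] :=
    ⟨u 0, u 1, u 2, by ext i; fin_cases i <;> rfl⟩
  have hx : IsLocalRing.residue O x = 0 := by simpa [hd] using huℓ
  obtain ⟨hq, -, i, hi⟩ := hsm
  have hyz : IsUnit y ∨ IsUnit z := by
    by_contra! hyz
    simp only [← IsLocalRing.residue_ne_zero_iff_isUnit, not_not] at hyz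
    apply hq
    ext i
    fin_cases i
    · exact hx
    · exact hyz.1
    · exact hyz.2
  -- The reduction is d x Q, whose y- and z-derivatives vanish on x = 0, so smoothness must come
  -- from the x-derivative.
  have hi' : aeval (IsLocalRing.residue O ∘ ![x, y, z]) (pderiv 0 (red U)) ≠ 0 := by
    obtain ⟨Q, hQ⟩ := hℓ.2.2.1
    have hx' : (IsLocalRing.residue O ∘ ![x, y, z]) 0 = 0 := hx
    rw [hQ] at hi ⊢
    have hne (j : Fin 3) (hj : j ≠ 0) :
        aeval (IsLocalRing.residue O ∘ ![x, y, z]) (pderiv j (C d * X 0 * Q)) = 0 := by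
      simp only [Derivation.leibniz, pderiv_C, pderiv_X_of_ne hj.symm, smul_eq_mul, map_add,
        map_mul, aeval_X, hx']
      simp
    by_cases h0 : i = 0
    · subst h0
      exact hi
    · exact absurd (hne i h0) hi
  have hd' : ¬ π ∣ eval ![x, y, z] (pderiv 0 U) := by
    rw [← residue_eq_zero_iff_dvd hπ, ← aeval_residue]
    rwa [red, pderiv_map, ← red] at hi'
  have key := covMax_eq_absVal_pow (K := K) hc hπ hU hα₁ hα hα'
    ((residue_eq_zero_iff_dvd hπ x).1 hx) hyz hu hd'
  rw [key]
  norm_cast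

theorem HasRatio.of_linSubst (hc : 1 < c) {g : Matrix (Fin 3) (Fin 3) O} (hg : IsUnit g.det)
    (hr : ∃ r, b₂ (map (algebraMap O K) (linSubst g U)) =
      algebraMap O K g.det ^ 2 * b₂ (map (algebraMap O K) U) + 12 * algebraMap O K r)
    {ℓ : MvPolynomial (Fin 3) (IsLocalRing.ResidueField O)} {α : ℤ}
    (h : HasRatio K c π (linSubst g U) (linSubst (g.map (IsLocalRing.residue O)) ℓ) α) :
    HasRatio K c π U ℓ α := by
  intro u hu huℓ hsm
  have hgu : g.mulVec (g⁻¹.mulVec u) = u := by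
    rw [Matrix.mulVec_mulVec, Matrix.mul_nonsing_inv _ hg, Matrix.one_mulVec]
  have hgq : (g.map (IsLocalRing.residue O)).mulVec (IsLocalRing.residue O ∘ g⁻¹.mulVec u) =
      IsLocalRing.residue O ∘ u := by
    have hmap (w : Fin 3 → O) :
        (g.map (IsLocalRing.residue O)).mulVec (IsLocalRing.residue O ∘ w) =
        IsLocalRing.residue O ∘ g.mulVec w := by
      ext i
      simp [Matrix.mulVec, dotProduct]
    rw [hmap, hgu]
  have hdet : (g.map (IsLocalRing.residue O)).det ≠ 0 := by
    have := (IsLocalRing.residue O).map_det g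
    rw [RingHom.mapMatrix_apply] at this
    rw [← this]
    exact (IsLocalRing.residue_ne_zero_iff_isUnit _).2 hg
  rw [← hgu, ← covMax_unimodular hc g hg U (g⁻¹.mulVec u) (by rw [hgu, hu]) hr]
  apply h
  · rw [eval_linSubst, hgu, hu]
  · rw [eval_linSubst, hgq, huℓ]
  · rw [red, map_linSubst]
    apply isSmoothPoint_linSubst hdet
    rw [← hgq] at hsm
    exact hsm

/-- Existence of the exponent may be checked after any substitution invertible over O that respects
b₂ up to 12 O; this allows ℓ to be normalised. -/
theorem exists_hasRatio_of_linSubst (hc : 1 < c) (hU : U.IsHomogeneous 3)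
    (hns : IsNonsingular (map (algebraMap O K) U)) {g g' : Matrix (Fin 3) (Fin 3) O}
    (hg : g * g' = 1)
    (hr : ∃ r, b₂ (map (algebraMap O K) (linSubst g U)) =
      algebraMap O K g.det ^ 2 * b₂ (map (algebraMap O K) U) + 12 * algebraMap O K r)
    {ℓ : MvPolynomial (Fin 3) (IsLocalRing.ResidueField O)}
    (hℓ : IsLineOfMultiplicityOne (red U) ℓ)
    (h : ∀ V : MvPolynomial (Fin 3) O, V.IsHomogeneous 3 →
      IsNonsingular (map (algebraMap O K) V) →
      IsLineOfMultiplicityOne (red V) (linSubst (g.map (IsLocalRing.residue O)) ℓ) →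
      ∃ α : ℤ, HasRatio K c π V (linSubst (g.map (IsLocalRing.residue O)) ℓ) α) :
    ∃ α : ℤ, HasRatio K c π U ℓ α := by
  have hdet : IsUnit g.det :=
    IsUnit.of_mul_eq_one g'.det (by rw [← Matrix.det_mul, hg, Matrix.det_one])
  obtain ⟨α, hα⟩ := h (linSubst g U) (isHomogeneous_linSubst g hU) (by
      rw [map_linSubst]
      refine hns.linSubst ?_
      have := (algebraMap O K).map_det g
      rw [RingHom.mapMatrix_apply] at this
      rw [← this]
      exact (hdet.map (algebraMap O K)).ne_zero) (by
      rw [red, map_linSubst]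
      refine hℓ.linSubst (g' := g'.map (IsLocalRing.residue O)) ?_
      rw [← Matrix.map_mul, hg]
      exact Matrix.map_one _ (map_zero _) (map_one _))
  exact ⟨α, hα.of_linSubst hc hdet hr⟩

theorem exists_hasRatio_of_ne_zero (hc : 1 < c) (hπ : Irreducible π)
    (hbd : ∀ V : MvPolynomial (Fin 3) O, V.IsHomogeneous 3 →
      IsNonsingular (map (algebraMap O K) V) → ∃ N, ¬ HasLineMod π V N)
    (hU : U.IsHomogeneous 3) (hns : IsNonsingular (map (algebraMap O K) U))
    {l₀ l₁ l₂ : IsLocalRing.ResidueField O} (hl : l₀ ≠ 0)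
    (hℓ : IsLineOfMultiplicityOne (red U) (C l₀ * X 0 + C l₁ * X 1 + C l₂ * X 2)) :
    ∃ α : ℤ, HasRatio K c π U (C l₀ * X 0 + C l₁ * X 1 + C l₂ * X 2) α := by
  obtain ⟨s, hs⟩ := IsLocalRing.residue_surjective (-(l₁ / l₀))
  obtain ⟨t, ht⟩ := IsLocalRing.residue_surjective (-(l₂ / l₀))
  have hlin : linSubst ((!![1, s, t; 0, 1, 0; 0, 0, 1] : Matrix (Fin 3) (Fin 3) O).map
      (IsLocalRing.residue O)) (C l₀ * X 0 + C l₁ * X 1 + C l₂ * X 2) = C l₀ * X 0 := by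
    simp only [linSubst, map_add, map_mul, algHom_C, aeval_X, Fin.sum_univ_three,
      MvPolynomial.algebraMap_eq]
    simp only [Matrix.map_apply, Matrix.of_apply, Matrix.cons_val', Matrix.cons_val_zero,
      Matrix.cons_val_one, Matrix.cons_val, Matrix.cons_val_fin_one, map_zero, map_one, hs, ht]
    have e1 : C l₀ * C (-(l₁ / l₀)) = (-C l₁ : MvPolynomial (Fin 3) _) := by
      rw [← C_mul, ← C_neg]; congr 1; field_simp
    have e2 : C l₀ * C (-(l₂ / l₀)) = (-C l₂ : MvPolynomial (Fin 3) _) := by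
      rw [← C_mul, ← C_neg]; congr 1; field_simp
    linear_combination X 1 * e1 + X 2 * e2
  refine exists_hasRatio_of_linSubst hc hU hns (g := !![1, s, t; 0, 1, 0; 0, 0, 1])
    (g' := !![1, -s, -t; 0, 1, 0; 0, 0, 1]) ?_ ?_ hℓ ?_
  · ext i j
    fin_cases i <;> fin_cases j <;> simp [Matrix.mul_apply, Fin.sum_univ_three]
  · obtain ⟨r, hr⟩ := b₂_unipotent (algebraMap O K) s t 0 hU
    exact ⟨r, by simpa [Matrix.det_fin_three] using hr⟩
  · rw [hlin]
    intro V hV hV' hℓV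
    obtain ⟨α, hα, -⟩ := exists_hasRatio_X_zero (K := K) hc hπ hV (hbd V hV hV') hl hℓV
    exact ⟨α, hα⟩

theorem exists_hasRatio (hc : 1 < c) (hπ : Irreducible π)
    (hbd : ∀ V : MvPolynomial (Fin 3) O, V.IsHomogeneous 3 →
      IsNonsingular (map (algebraMap O K) V) → ∃ N, ¬ HasLineMod π V N)
    (hU : U.IsHomogeneous 3) (hns : IsNonsingular (map (algebraMap O K) U))
    {ℓ : MvPolynomial (Fin 3) (IsLocalRing.ResidueField O)}
    (hℓ : IsLineOfMultiplicityOne (red U) ℓ) : ∃ α : ℤ, HasRatio K c π U ℓ α := by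
  obtain ⟨l₀, l₁, l₂, rfl⟩ := isHomogeneous_one_eq hℓ.2.1
  by_cases h0 : l₀ = 0
  · by_cases h1 : l₁ = 0
    · have h2 : l₂ ≠ 0 := by
        rintro rfl
        exact hℓ.1 (by simp [h0, h1])
      refine exists_hasRatio_of_linSubst hc hU hns (g := !![0, 0, 1; 0, 1, 0; 1, 0, 0])
        (g' := !![0, 0, 1; 0, 1, 0; 1, 0, 0]) ?_ ⟨0, ?_⟩ hℓ ?_
      · ext i j
        fin_cases i <;> fin_cases j <;> simp [Matrix.mul_apply, Fin.sum_univ_three]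
      · have hK : (!![0, 0, 1; 0, 1, 0; 1, 0, 0] : Matrix (Fin 3) (Fin 3) O).map
            (algebraMap O K) = !![0, 0, 1; 0, 1, 0; 1, 0, 0] := by
          ext i j
          fin_cases i <;> fin_cases j <;> simp
        rw [map_linSubst, hK, b₂_swap02 (hU.map _)]
        simp [Matrix.det_fin_three]
      · have hlin : linSubst ((!![0, 0, 1; 0, 1, 0; 1, 0, 0] : Matrix (Fin 3) (Fin 3) O).map
            (IsLocalRing.residue O)) (C l₀ * X 0 + C l₁ * X 1 + C l₂ * X 2) =
            C l₂ * X 0 + C l₁ * X 1 + C l₀ * X 2 := by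
          simp [linSubst, Fin.sum_univ_three, h0, h1]
        rw [hlin]
        intro V hV hV' hℓV
        exact exists_hasRatio_of_ne_zero hc hπ hbd hV hV' h2 hℓV
    · refine exists_hasRatio_of_linSubst hc hU hns (g := !![0, 1, 0; 1, 0, 0; 0, 0, 1])
        (g' := !![0, 1, 0; 1, 0, 0; 0, 0, 1]) ?_ ⟨0, ?_⟩ hℓ ?_
      · ext i j
        fin_cases i <;> fin_cases j <;> simp [Matrix.mul_apply, Fin.sum_univ_three]
      · have hK : (!![0, 1, 0; 1, 0, 0; 0, 0, 1] : Matrix (Fin 3) (Fin 3) O).map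
            (algebraMap O K) = !![0, 1, 0; 1, 0, 0; 0, 0, 1] := by
          ext i j
          fin_cases i <;> fin_cases j <;> simp
        rw [map_linSubst, hK, b₂_swap01 (hU.map _)]
        simp [Matrix.det_fin_three]
      · have hlin : linSubst ((!![0, 1, 0; 1, 0, 0; 0, 0, 1] : Matrix (Fin 3) (Fin 3) O).map
            (IsLocalRing.residue O)) (C l₀ * X 0 + C l₁ * X 1 + C l₂ * X 2) =
            C l₁ * X 0 + C l₀ * X 1 + C l₂ * X 2 := by
          simp [linSubst, Fin.sum_univ_three, h0]
        rw [hlin]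
        intro V hV hV' hℓV
        exact exists_hasRatio_of_ne_zero hc hπ hbd hV hV' h1 hℓV
  · exact exists_hasRatio_of_ne_zero hc hπ hbd hU hns h0 hℓ

/-- The ratio is homogeneous of degree 0, and for coordinates in O with nonzero reduction its
denominator is 1. -/
theorem HasRatio.localRatio_eq (hc : 1 < c) (hU : U.IsHomogeneous 3)
    {ℓ : MvPolynomial (Fin 3) (IsLocalRing.ResidueField O)} {α : ℤ} (h : HasRatio K c π U ℓ α)
    {x : Fin 3 → K} {q : Fin 3 → IsLocalRing.ResidueField O}
    (hxU : eval x (map (algebraMap O K) U) = 0) (hxq : ReducesTo x q) (hqℓ : eval q ℓ = 0)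
    (hq : IsSmoothPoint (red U) q) :
    localRatio c U x = absVal O c (algebraMap O K π) ^ (2 * α) := by
  obtain ⟨hq0, d, hd, u, hu, huq⟩ := hxq
  obtain rfl : IsLocalRing.residue O ∘ u = q := funext huq
  have hux : algebraMap O K ∘ u = d • x := funext hu
  have huU : eval u U = 0 := by
    apply IsFractionRing.injective O K
    rw [map_zero, map_eval, hux, eval_smul_of_isHomogeneous (hU.map _), hxU, mul_zero]
  have key := h u huU hqℓ hq
  rw [hux, covMax_smul hc (hU.map _) hxU hd] at key
  have hmax : absVal O c d *
      max (max (absVal O c (x 0)) (absVal O c (x 1))) (absVal O c (x 2)) = 1 := by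
    rw [mul_max_of_nonneg _ _ (absVal_nonneg hc d), mul_max_of_nonneg _ _ (absVal_nonneg hc d),
      ← absVal_mul hc, ← absVal_mul hc, ← absVal_mul hc, ← hu, ← hu, ← hu]
    have hle (i : Fin 3) := absVal_algebraMap_le_one (K := K) hc (u i)
    apply le_antisymm (max_le (max_le (hle 0) (hle 1)) (hle 2))
    obtain ⟨i, hi⟩ := Function.ne_iff.1 hq0
    have h1 := absVal_algebraMap_of_isUnit (K := K) hc
      ((IsLocalRing.residue_ne_zero_iff_isUnit (u i)).1 hi)
    fin_cases i
    · exact le_max_of_le_left (le_max_of_le_left h1.ge)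
    · exact le_max_of_le_left (le_max_of_le_right h1.ge)
    · exact le_max_of_le_right h1.ge
  have hcov : localRatio c U x = covMax O c (map (algebraMap O K) U) x /
      max (max (absVal O c (x 0)) (absVal O c (x 1))) (absVal O c (x 2)) ^ 6 := by
    rw [localRatio, covMax, F₃, G₃, map_pow]
  have hM := right_ne_zero_of_mul_eq_one hmax
  rw [hcov, ← key, div_eq_iff (pow_ne_zero 6 hM)]
  linear_combination (-covMax O c (map (algebraMap O K) U) x) *
    congrArg (fun t => t ^ 6) hmax

end DVR

end TernaryCubic

theorem mainTheorem8 (p : ℕ) [Fact p.Prime] (K : Type*) [Field K] [Algebra ℚ_[p] K]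
    [FiniteDimensional ℚ_[p] K] [Algebra ℤ_[p] K] [IsScalarTower ℤ_[p] ℚ_[p] K]
    (π : integralClosure ℤ_[p] K) (hπ : Irreducible π) (c : ℝ) (hc : 1 < c)
    (U : MvPolynomial (Fin 3) (integralClosure ℤ_[p] K)) (hU : U.IsHomogeneous 3)
    (hns : TernaryCubic.IsNonsingular
      (MvPolynomial.map (algebraMap (integralClosure ℤ_[p] K) K) U))
    (ℓ : MvPolynomial (Fin 3) (IsLocalRing.ResidueField (integralClosure ℤ_[p] K)))
    (hℓ : TernaryCubic.IsLineOfMultiplicityOne (TernaryCubic.red U) ℓ) :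
    ∃ α : ℤ,
      (∀ (x : Fin 3 → K) (q : Fin 3 → IsLocalRing.ResidueField (integralClosure ℤ_[p] K)),
        x ≠ 0 →
        MvPolynomial.eval x (MvPolynomial.map (algebraMap (integralClosure ℤ_[p] K) K) U) = 0 →
        TernaryCubic.ReducesTo x q →
        MvPolynomial.eval q ℓ = 0 →
        TernaryCubic.IsSmoothPoint (TernaryCubic.red U) q →
        TernaryCubic.localRatio c U x =
          TernaryCubic.absVal (integralClosure ℤ_[p] K) c
            (algebraMap (integralClosure ℤ_[p] K) K π) ^ (2 * α)) ∧
      ((∃ d : IsLocalRing.ResidueField (integralClosure ℤ_[p] K), d ≠ 0 ∧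
          ℓ = MvPolynomial.C d * MvPolynomial.X 0) →
        TernaryCubic.AlgComputes π U α) := by
  have : CharZero K := charZero_of_injective_algebraMap (algebraMap ℚ_[p] K).injective
  -- Only the line x = 0 must give one α serving both claims; for any other line the claim about the
  -- algorithm is vacuous.
  by_cases h : ∃ d : IsLocalRing.ResidueField (integralClosure ℤ_[p] K), d ≠ 0 ∧
      ℓ = MvPolynomial.C d * MvPolynomial.X 0
  · obtain ⟨d, hd, rfl⟩ := h
    obtain ⟨α, hα, halg⟩ := TernaryCubic.exists_hasRatio_X_zero (K := K) hc hπ hU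
      (TernaryCubic.exists_not_hasLineMod p K hπ hU hns) hd hℓ
    exact ⟨α, fun x q _ hxU hxq hqℓ hq => hα.localRatio_eq hc hU hxU hxq hqℓ hq, fun _ => halg⟩
  · obtain ⟨α, hα⟩ := TernaryCubic.exists_hasRatio (K := K) hc hπ
      (fun V hV hV' => TernaryCubic.exists_not_hasLineMod p K hπ hV hV') hU hns hℓ
    exact ⟨α, fun x q _ hxU hxq hqℓ hq => hα.localRatio_eq hc hU hxU hxq hqℓ hq,
      fun h' => absurd h' h⟩
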